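/- Let $k\ge 2$ be an integer and let $\alpha\in\mathbb C$ with $0<|\alpha|<2$. For a bounded function $f:\mathbb R\to\mathbb C$ and an integer $N\ge 2$ put $$S_{f}(k,\alpha;N)=\sum_{\substack{n\ k\text{-free}\\ p\mid n\Rightarrow p\le N}} f\!\left(\frac{\log n}{\log N}\right)\frac{\alpha^{\Omega(n)}}{n},$$ where $n\ge 1$ is $k$-free if $p^k\nmid n$ for every prime $p$, and $\Omega(n)$ is the number of prime factors of $n$ counted with multiplicity. Let $$\varphi^{(\alpha)}(\lambda)=\exp\left\{\alpha\int_0^1\frac{e^{i\lambda v}-1}{v}\,dv\right\},\qquad R(N)=\frac{\log N}{\log\log N},$$ let $\hat f$ denote the Fourier transform of $f$ (in the sense of tempered distributions, normalized so that $\hat f(\lambda)=\frac1{2\pi}\int e^{-i\lambda x}f(x)\,dx$ for integrable $f$), and let $\mathcal S_\eta$ be the set of all $f:\mathbb R\to\mathbb C$ for which $\hat f$ is a function with $|\hat f(\lambda)|\le C_0/(1+|\lambda|^\eta)$ for all $\lambda\in\mathbb R$, for some $C_0>0$. Then there is a constant $C=C(k,\alpha)\ne0$ such that for every $\eta>|\alpha|-\Re\alpha$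 and every bounded $f\in\mathcal S_\eta$ (assumed continuous if $\eta>1$) the numbers $\varepsilon_N$ given by $$S_{f}(k,\alpha;N)=C\,(\log N)^\alpha\left(\int_{|\lambda|\le R(N)}\varphi^{(\alpha)}(\lambda)\hat f(\lambda)\,d\lambda+\varepsilon_N\right)\qquad(N\ge2)$$ satisfy, as $N\to\infty$, with implied constants that may depend on $k,\alpha,\eta,f$: $$\varepsilon_N=\begin{cases}O\!\left(\dfrac{\log\log N}{\log N}\right)&\text{if }\eta>|\alpha|-\Re\alpha+2,\\[2ex] O\!\left(\dfrac{(\log\log N)^{\eta-1}}{(\log N)^{\eta-(|\alpha|-\Re\alpha+1)}}\right)&\text{if }|\alpha|-\Re\alpha<\eta\le|\alpha|-\Re\alpha+2.\end{cases}$$ Moreover, $\varepsilon_N\to0$ whenever $\eta>|\alpha|-\Re\alpha+1$. -/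

import Mathlib

open scoped SchwartzMap

noncomputable section

/-- The positive integers that are `k`-free (`p ^ k ∤ n` for every prime `p`) and all of whose
prime factors are at most `N`. -/
def smoothKFree (k N : ℕ) : Set ℕ :=
  {n | n ≠ 0 ∧ (∀ p : ℕ, p.Prime → ¬ p ^ k ∣ n) ∧ ∀ p : ℕ, p.Prime → p ∣ n → p ≤ N}

/-- There are only finitely many such integers, so that the finite sum `smoothSum` below ranges
over all of them. -/
theorem smoothKFree_finite (k N : ℕ) : (smoothKFree k N).Finite := by
  have h0 : (primorial N) ^ k ≠ 0 := pow_ne_zero _ (primorial_pos N).ne'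
  refine (((primorial N) ^ k).divisors.finite_toSet).subset ?_
  rintro n ⟨hn, hk, hN⟩
  simp only [Finset.mem_coe, Nat.mem_divisors]
  refine ⟨?_, h0⟩
  rw [← Nat.factorization_prime_le_iff_dvd hn h0]
  intro p hp
  by_cases hpn : p ∣ n
  · have hlt : n.factorization p ≤ k := by
      by_contra! h
      exact hk p hp ((hp.pow_dvd_iff_le_factorization hn).2 h.le)
    have hpd : p ∣ primorial N :=
      Finset.dvd_prod_of_mem (fun q => q)
        (Finset.mem_filter.2 ⟨Finset.mem_range.2 (Nat.lt_succ_of_le (hN p hp hpn)), hp⟩)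
    exact hlt.trans ((hp.pow_dvd_iff_le_factorization h0).1 (pow_dvd_pow_of_dvd hpd k))
  · simp [Nat.factorization_eq_zero_of_not_dvd hpn]

/-- The sum `∑ f (log n / log N) * α ^ Ω(n) / n` over the `k`-free integers `n` with no prime
factor exceeding `N`; `Ω(n)` is the number of prime factors of `n` counted with multiplicity. -/
def smoothSum (f : ℝ → ℂ) (k : ℕ) (α : ℂ) (N : ℕ) : ℂ :=
  ∑ᶠ n ∈ smoothKFree k N,
    f (Real.log n / Real.log N) * (α ^ (ArithmeticFunction.cardFactors n) / (n : ℂ))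

/-- `φ^(α)(t) = exp (α ∫₀¹ (e^{itv} - 1) / v dv)`. -/
def dickmanChar (α : ℂ) (t : ℝ) : ℂ :=
  Complex.exp (α * ∫ v in (0 : ℝ)..1, (Complex.exp (Complex.I * t * v) - 1) / (v : ℂ))

/-- The Fourier integral `(1 / 2π) ∫ e^{-itx} ψ(t) dt`, in the normalization in which the
inversion formula reads `ψ(t) = ∫ e^{itx} ψ̂(x) dx`. -/
def fourierHat (ψ : ℝ → ℂ) (x : ℝ) : ℂ :=
  (2 * Real.pi : ℂ)⁻¹ * ∫ t : ℝ, Complex.exp (-(Complex.I * t * x)) * ψ t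

/-- The function `g` is the Fourier transform of the function `f`, in the sense of tempered
distributions: `∫ g ψ = ∫ f ψ̂` for all Schwartz functions `ψ`, both integrals being absolutely
convergent. For integrable `f` this is the function `fourierHat f`, up to almost everywhere
equality. -/
def IsFourierTransform (f g : ℝ → ℂ) : Prop :=
  ∀ ψ : 𝓢(ℝ, ℂ),
    MeasureTheory.Integrable (fun t : ℝ => g t * ψ t) ∧
    MeasureTheory.Integrable (fun x : ℝ => f x * fourierHat ψ x) ∧
    ∫ t : ℝ, g t * ψ t = ∫ x : ℝ, f x * fourierHat ψ x

/-- The space `𝓢_η(ℝ)` of the functions `f : ℝ → ℂ` whose Fourier transform is a function bounded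
by a constant multiple of `1 / (1 + |t| ^ η)`. -/
def fourierDecay (η : ℝ) : Set (ℝ → ℂ) :=
  {f | ∃ g : ℝ → ℂ, IsFourierTransform f g ∧
    ∃ C : ℝ, 0 < C ∧ ∀ t : ℝ, ‖g t‖ ≤ C / (1 + |t| ^ η)}

/-- The cut-off `R(N) = log N / log log N`. -/
def cutoff (N : ℕ) : ℝ := Real.log N / Real.log (Real.log N)

end

/-! Write `a = ‖α‖ - α.re`, `L = log N`, `ℓ = log log N` and `R = L / ℓ`. When `f` is the inverse
Fourier transform of an integrable `g`, the sum becomes `∫ g(t) P(t / L) dt`, where `P` is the Euler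
product with factors `1 + z + ⋯ + z ^ (k - 1)` at `z = α p^{it} / p` (`smoothSum_eq_integral`).
Everything rests on the size of `P`.

Since `‖α‖ < 2`, every `z` lies in a fixed smaller disc and each factor is `exp (z + O(z²))`. The
second order terms converge. The first order terms are `α ∑ 1 / p`, governed by the second theorem
of Mertens, and `α ∑ (p^{it} - 1) / p`, which partial summation compares with the exponent of
`dickmanChar` at `t L`. Thus `P(t) = C L^α φ(t L) e^δ` with `δ = O(1 / L + |t| (1 + ℓ))`
(`exists_smoothEulerProduct_eq`).

At `t / L` this reads `δ = O((1 + |t|) / R)`, so `R` is the range in which the approximation is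
useful. For `|t| ≤ R` the relative error is `O((1 + |t|) / R)`; together with `φ(t) = O((1 +
|t|)^(-α.re))` and the decay of `g` it contributes `1 / R + R^(a + 1 - η)`. For `|t| > R` the
product is only bounded by its majorant `O(L^‖α‖)`; after division by `L^α` the tail of `g`
contributes `L^a R^(1 - η)`, which is `R^(a + 1 - η) ℓ^a`. The sum of the two is `errorBound`, and
the two ranges of `η` record which of its terms dominates.

For `η ≤ 1` the function `g` need not be integrable and inversion is not available, but the claim is
then so weak that the sum and the truncated integral can be bounded separately, without any
cancellation. -/

open scoped FourierTransform

/-! ### Mertens' first theorem. -/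

/-- `log n / n ^ 2` is summable. -/
theorem summable_log_div_sq : Summable fun n : ℕ => Real.log n / (n : ℝ) ^ 2 := by
  have h : Summable fun n : ℕ => 2 * (1 / (n : ℝ) ^ (3 / 2 : ℝ)) :=
    (Real.summable_one_div_nat_rpow.2 (by norm_num)).mul_left 2
  refine h.of_nonneg_of_le (fun n => by positivity) fun n => ?_
  rcases Nat.eq_zero_or_pos n with rfl | hn
  · simp
  have hn' : (0 : ℝ) < n := by exact_mod_cast hn
  have h1 : Real.log n ≤ (n : ℝ) ^ (1 / 2 : ℝ) / (1 / 2) :=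
    Real.log_le_rpow_div hn'.le (by norm_num)
  have h2 : (n : ℝ) ^ 2 = (n : ℝ) ^ (1 / 2 : ℝ) * (n : ℝ) ^ (3 / 2 : ℝ) := by
    rw [← Real.rpow_add hn', ← Real.rpow_natCast]; norm_num
  have h3 : 0 < (n : ℝ) ^ (1 / 2 : ℝ) := Real.rpow_pos_of_pos hn' _
  have h4 : 0 < (n : ℝ) ^ (3 / 2 : ℝ) := Real.rpow_pos_of_pos hn' _
  rw [h2, div_le_iff₀ (by positivity)]
  calc _ ≤ _ := h1
    _ = _ := by field_simp

/-- `log n!` in terms of the valuations of `n!`. -/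
theorem log_factorial_eq_sum_primes (n : ℕ) :
    Real.log (n.factorial) = ∑ p ∈ Nat.primesLE n, (padicValNat p n.factorial : ℝ) * Real.log p := by
  rw [Real.log_nat_eq_sum_factorization, Finsupp.sum_of_support_subset (s := Nat.primesLE n)]
  · refine Finset.sum_congr rfl fun p hp => ?_
    rw [Nat.factorization_def _ (Nat.prime_of_mem_primesLE hp)]
  · intro p hp
    simp only [Nat.support_factorization, Nat.mem_primeFactors] at hp
    exact Nat.mem_primesLE.2 ⟨(hp.1.dvd_factorial).1 hp.2.1, hp.1⟩
  · simp

theorem div_le_padicValNat_factorial {p : ℕ} (hp : p.Prime) (n : ℕ) :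
    n / p ≤ padicValNat p n.factorial := by
  have := Fact.mk hp
  rw [← padicValNat_mul_div_factorial, padicValNat_factorial_mul]
  omega

/-- Legendre's formula: the left side is `n` minus the sum of the base `p` digits of `n`. -/
theorem padicValNat_factorial_mul_sub_one_le {p : ℕ} (hp : p.Prime) (n : ℕ) :
    (padicValNat p n.factorial : ℝ) * (p - 1) ≤ n := by
  have := Fact.mk hp
  have h := sub_one_mul_padicValNat_factorial (p := p) n
  have h1 : (p - 1) * padicValNat p n.factorial ≤ n := h ▸ Nat.sub_le _ _
  have h2 : (((p - 1 : ℕ) : ℝ)) = p - 1 := by rw [Nat.cast_sub hp.one_le]; simp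
  rw [mul_comm, ← h2]; exact_mod_cast h1

/-- The first theorem of Mertens. -/
theorem exists_abs_sum_log_div_prime_sub_log_le :
    ∃ M : ℝ, 0 < M ∧ ∀ n : ℕ, 1 ≤ n →
      |∑ p ∈ Nat.primesLE n, Real.log p / p - Real.log n| ≤ M := by
  set K := 2 * ∑' n : ℕ, Real.log n / (n : ℝ) ^ 2
  have hK : 0 ≤ K := mul_nonneg (by norm_num) (tsum_nonneg fun n => by positivity)
  -- Both bounds evaluate `log n!` by valuations. `log 4` is Chebyshev's bound for the loss in
  -- rounding `n / p` down, `K` pays for replacing `1 / (p - 1)` by `1 / p`, and `1` comes from `log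
  -- n! ≥ n log n - n`.
  refine ⟨1 + K + Real.log 4, by positivity, fun n hn => ?_⟩
  have hn' : (0 : ℝ) < n := by exact_mod_cast hn
  have hlow : (n : ℝ) * ∑ p ∈ Nat.primesLE n, Real.log p / p - Real.log 4 * n
      ≤ Real.log n.factorial := by
    have hθ : ∑ p ∈ Nat.primesLE n, Real.log p ≤ Real.log 4 * n := by
      rw [← Chebyshev.theta_eq_sum_primesLE_log]; exact Chebyshev.theta_le_log4_mul_x hn'.le
    have : (n : ℝ) * ∑ p ∈ Nat.primesLE n, Real.log p / p - ∑ p ∈ Nat.primesLE n, Real.log p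
        ≤ Real.log n.factorial := by
      rw [log_factorial_eq_sum_primes, Finset.mul_sum, ← Finset.sum_sub_distrib]
      refine Finset.sum_le_sum fun p hp => ?_
      have hpp := Nat.prime_of_mem_primesLE hp
      have hl : 0 ≤ Real.log p := Real.log_natCast_nonneg p
      have h1 : (n : ℝ) / p - 1 ≤ padicValNat p n.factorial := by
        have h2 : (n : ℝ) / p < ((n / p : ℕ) : ℝ) + 1 := by
          rw [← Nat.floor_div_eq_div (K := ℝ)]; exact Nat.lt_floor_add_one _
        have h3 : ((n / p : ℕ) : ℝ) ≤ padicValNat p n.factorial := by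
          exact_mod_cast div_le_padicValNat_factorial hpp n
        linarith
      calc _ = ((n : ℝ) / p - 1) * Real.log p := by ring
        _ ≤ _ := by gcongr
    linarith
  have hup : Real.log n.factorial ≤ n * (∑ p ∈ Nat.primesLE n, Real.log p / p + K) := by
    have h1 : Real.log n.factorial ≤
        n * ∑ p ∈ Nat.primesLE n, (Real.log p / p + 2 * (Real.log p / (p : ℝ) ^ 2)) := by
      rw [log_factorial_eq_sum_primes, Finset.mul_sum]
      refine Finset.sum_le_sum fun p hp => ?_
      have hpp := Nat.prime_of_mem_primesLE hp
      have hl : 0 ≤ Real.log p := Real.log_natCast_nonneg p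
      have hp2 : (2 : ℝ) ≤ p := by exact_mod_cast hpp.two_le
      have h2 := padicValNat_factorial_mul_sub_one_le hpp n
      have h3 : (padicValNat p n.factorial : ℝ) ≤ n * (1 / p + 2 / (p : ℝ) ^ 2) := by
        have h4 : (padicValNat p n.factorial : ℝ) ≤ n / (p - 1) := by
          rw [le_div_iff₀ (by linarith)]; exact h2
        have h5 : (1 : ℝ) / (p - 1) ≤ 1 / p + 2 / (p : ℝ) ^ 2 := by
          rw [div_le_iff₀ (by linarith)]
          field_simp
          nlinarith
        calc _ ≤ (n : ℝ) * (1 / (p - 1)) := by rw [mul_one_div]; exact h4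
          _ ≤ _ := by gcongr
      calc _ ≤ (n * (1 / p + 2 / (p : ℝ) ^ 2)) * Real.log p := by gcongr
        _ = _ := by ring
    refine h1.trans ?_
    rw [Finset.sum_add_distrib, ← Finset.mul_sum]
    gcongr
    exact mul_le_mul_of_nonneg_left
      (summable_log_div_sq.sum_le_tsum _ fun i _ => by positivity) (by norm_num)
  have hfl : (n : ℝ) * Real.log n - n ≤ Real.log n.factorial := by
    have := Stirling.le_log_factorial_stirling (n := n) (by omega)
    have h1 : 0 ≤ Real.log n := Real.log_natCast_nonneg n
    have h2 : 0 ≤ Real.log (2 * Real.pi) := Real.log_nonneg (by nlinarith [Real.pi_gt_three])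
    linarith
  have hfu : Real.log n.factorial ≤ n * Real.log n := by
    rw [← Real.log_pow]
    refine Real.log_le_log (by exact_mod_cast n.factorial_pos) ?_
    exact_mod_cast Nat.factorial_le_pow n
  set A := ∑ p ∈ Nat.primesLE n, Real.log p / p
  have h4 : 0 ≤ Real.log 4 := Real.log_nonneg (by norm_num)
  have h5 : A - Real.log 4 ≤ Real.log n := le_of_mul_le_mul_left (by linarith) hn'
  have h6 : Real.log n - 1 ≤ A + K := le_of_mul_le_mul_left (by linarith) hn'
  rw [abs_le]; constructor <;> linarith

/-- The first theorem of Mertens, at real arguments. -/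
theorem exists_abs_sum_log_div_prime_floor_sub_log_le :
    ∃ M : ℝ, 0 < M ∧ ∀ x : ℝ, 1 ≤ x →
      |∑ p ∈ Nat.primesLE ⌊x⌋₊, Real.log p / p - Real.log x| ≤ M := by
  obtain ⟨M, hM, h⟩ := exists_abs_sum_log_div_prime_sub_log_le
  refine ⟨M + Real.log 2, by positivity, fun x hx => ?_⟩
  have h1 : 1 ≤ ⌊x⌋₊ := Nat.one_le_floor_iff x |>.2 hx
  have h1' : (1 : ℝ) ≤ ⌊x⌋₊ := by exact_mod_cast h1
  have h2 := h _ h1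
  have h3 : Real.log ⌊x⌋₊ ≤ Real.log x :=
    Real.log_le_log (by linarith) (Nat.floor_le (by linarith))
  have h4 : Real.log x ≤ Real.log 2 + Real.log ⌊x⌋₊ := by
    rw [← Real.log_mul (by norm_num) (by linarith)]
    exact Real.log_le_log (by linarith) (by linarith [Nat.lt_floor_add_one x])
  rw [abs_le] at *
  constructor <;> linarith [h2.1, h2.2]

/-! ### Partial summation over primes and Mertens' second theorem. -/

/-- Partial summation over primes against a differentiable weight. The function `V` is an
antiderivative of `W x / x`, and `G'` is a majorant of `‖W'‖`. -/
theorem exists_norm_sum_log_div_prime_mul_sub_le :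
    ∃ M : ℝ, 0 < M ∧ ∀ (a b : ℝ) (W W' V : ℝ → ℂ) (G G' : ℝ → ℝ), 1 < a → a ≤ b →
      (∀ x ∈ Set.Icc a b, HasDerivAt W (W' x) x) →
      (∀ x ∈ Set.Icc a b, HasDerivAt V (W x / x) x) →
      (∀ x ∈ Set.Icc a b, HasDerivAt G (G' x) x) →
      ContinuousOn W' (Set.Icc a b) → ContinuousOn G' (Set.Icc a b) →
      (∀ x ∈ Set.Icc a b, ‖W' x‖ ≤ G' x) →
      ‖∑ p ∈ Finset.Ioc ⌊a⌋₊ ⌊b⌋₊ with p.Prime, W p * (Real.log p / p) - (V b - V a)‖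
        ≤ M * (‖W a‖ + ‖W b‖ + (G b - G a)) := by
  obtain ⟨M, hM, hA⟩ := exists_abs_sum_log_div_prime_floor_sub_log_le
  refine ⟨M, hM, fun a b W W' V G G' ha hab hW hV hG hWc hGc hWG => ?_⟩
  set A : ℝ → ℝ := fun x => ∑ p ∈ Nat.primesLE ⌊x⌋₊, Real.log p / p
  set c : ℕ → ℂ := fun n => if n.Prime then ((Real.log n / n : ℝ) : ℂ) else 0
  have hc : ∀ x : ℝ, ∑ k ∈ Finset.Icc 0 ⌊x⌋₊, c k = (A x : ℂ) := by
    intro x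
    simp only [c, A, Nat.primesLE_eq_filter_Icc_zero, Finset.sum_filter, Complex.ofReal_sum]
    refine Finset.sum_congr rfl fun p _ => ?_
    split_ifs <;> simp
  have hsum : ∑ p ∈ Finset.Ioc ⌊a⌋₊ ⌊b⌋₊ with p.Prime, W p * (Real.log p / p) =
      ∑ p ∈ Finset.Ioc ⌊a⌋₊ ⌊b⌋₊, W p * c p := by
    rw [Finset.sum_filter]
    refine Finset.sum_congr rfl fun p _ => ?_
    simp only [c]
    split_ifs <;> simp
  have hder : ∀ x ∈ Set.Icc a b, deriv W x = W' x := fun x hx => (hW x hx).deriv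
  have hWi : MeasureTheory.IntegrableOn W' (Set.Icc a b) := hWc.integrableOn_Icc
  have hWi' : MeasureTheory.IntegrableOn (deriv W) (Set.Icc a b) :=
    hWi.congr_fun (fun x hx => (hder x hx).symm) measurableSet_Icc
  have hab' : Set.uIcc a b = Set.Icc a b := Set.uIcc_of_le hab
  have hAm : MeasureTheory.IntegrableOn (fun x => W' x * (A x : ℂ)) (Set.Icc a b) := by
    refine (integrableOn_mul_sum_Icc c (by linarith) (m := 0) hWi).congr_fun (fun x hx => ?_)
      measurableSet_Icc
    simp only [hc]
  have hlogc : ContinuousOn (fun x : ℝ => ((Real.log x : ℝ) : ℂ)) (Set.Icc a b) := by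
    refine Complex.continuous_ofReal.comp_continuousOn ?_
    exact Real.continuousOn_log.mono fun x hx => by
      simp only [Set.mem_compl_iff, Set.mem_singleton_iff]; linarith [hx.1]
  have hlogi : IntervalIntegrable (fun x => W' x * (Real.log x : ℂ)) MeasureTheory.volume a b :=
    ContinuousOn.intervalIntegrable (by rw [hab']; exact hWc.mul hlogc)
  have hAi : IntervalIntegrable (fun x => W' x * (A x : ℂ)) MeasureTheory.volume a b :=
    (intervalIntegrable_iff_integrableOn_Icc_of_le hab).2 hAm
  -- With `log` in place of the prime sum `A`, integration by parts produces the main term `V b - V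
  -- a` exactly. Only `A - log` is left, and Mertens' first theorem bounds it by `M`.
  have hibp : ∫ x in a..b, W' x * (Real.log x : ℂ) =
      (W b * Real.log b - V b) - (W a * Real.log a - V a) := by
    refine intervalIntegral.integral_eq_sub_of_hasDerivAt
      (f := fun x => W x * (Real.log x : ℂ) - V x) (fun x hx => ?_) hlogi
    rw [hab'] at hx
    have hl : HasDerivAt (fun y : ℝ => ((Real.log y : ℝ) : ℂ)) ((x⁻¹ : ℝ) : ℂ) x :=
      (Real.hasDerivAt_log (by linarith [hx.1])).ofReal_comp
    refine (((hW x hx).mul hl).sub (hV x hx)).congr_deriv ?_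
    push_cast
    ring
  rw [hsum, sum_mul_eq_sub_sub_integral_mul c (by linarith) hab
    (fun t ht => (hW t ht).differentiableAt) hWi', hc, hc]
  have hint : ∫ t in Set.Ioc a b, deriv W t * ∑ k ∈ Finset.Icc 0 ⌊t⌋₊, c k =
      ∫ x in a..b, W' x * (A x : ℂ) := by
    rw [intervalIntegral.integral_of_le hab]
    refine MeasureTheory.setIntegral_congr_fun measurableSet_Ioc fun x hx => ?_
    simp only [hc, hder x (Set.Ioc_subset_Icc_self hx)]
  rw [hint]
  have hsplit : ∫ x in a..b, W' x * (A x : ℂ) = ∫ x in a..b, W' x * (Real.log x : ℂ) +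
      W' x * ((A x - Real.log x : ℝ) : ℂ) := by
    congr 1; ext x; push_cast; ring
  have hri : IntervalIntegrable (fun x => W' x * ((A x - Real.log x : ℝ) : ℂ))
      MeasureTheory.volume a b := by
    refine (hAi.sub hlogi).congr (fun x _ => ?_)
    simp only [Complex.ofReal_sub]; ring
  rw [hsplit, intervalIntegral.integral_add hlogi hri, hibp]
  have hrb : ∀ x ∈ Set.Icc a b, ‖((A x - Real.log x : ℝ) : ℂ)‖ ≤ M := fun x hx => by
    rw [Complex.norm_real]; exact hA x (by linarith [hx.1])
  have hGi : IntervalIntegrable G' MeasureTheory.volume a b :=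
    ContinuousOn.intervalIntegrable (by rwa [hab'])
  have hrest : ‖∫ x in a..b, W' x * ((A x - Real.log x : ℝ) : ℂ)‖ ≤ M * (G b - G a) := by
    rw [← intervalIntegral.integral_eq_sub_of_hasDerivAt (by rwa [hab']) hGi,
      ← intervalIntegral.integral_const_mul]
    refine intervalIntegral.norm_integral_le_of_norm_le hab
      (Filter.Eventually.of_forall fun x hx => ?_) (hGi.const_mul M)
    have hx' := Set.Ioc_subset_Icc_self hx
    rw [norm_mul, mul_comm]
    exact mul_le_mul (hrb x hx') (hWG x hx') (norm_nonneg _) hM.le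
  have hkey : W b * (A b : ℂ) - W a * (A a : ℂ) -
      (W b * Real.log b - V b - (W a * Real.log a - V a) +
        ∫ x in a..b, W' x * ((A x - Real.log x : ℝ) : ℂ)) - (V b - V a) =
      W b * ((A b - Real.log b : ℝ) : ℂ) - W a * ((A a - Real.log a : ℝ) : ℂ) -
        ∫ x in a..b, W' x * ((A x - Real.log x : ℝ) : ℂ) := by
    push_cast; ring
  rw [hkey]
  have h1 : ‖W b * ((A b - Real.log b : ℝ) : ℂ)‖ ≤ M * ‖W b‖ := by
    rw [norm_mul, mul_comm]; gcongr; exact hrb b ⟨hab, le_rfl⟩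
  have h2 : ‖W a * ((A a - Real.log a : ℝ) : ℂ)‖ ≤ M * ‖W a‖ := by
    rw [norm_mul, mul_comm]; gcongr; exact hrb a ⟨le_rfl, hab⟩
  calc _ ≤ _ := (norm_sub_le _ _).trans (add_le_add (norm_sub_le _ _) le_rfl)
    _ ≤ _ := by linarith

theorem sum_primesLE_sub_sum_primesLE {E : Type*} [AddCommGroup E] (g : ℕ → E) {m n : ℕ}
    (h : m ≤ n) :
    ∑ p ∈ Nat.primesLE n, g p - ∑ p ∈ Nat.primesLE m, g p =
      ∑ p ∈ Finset.Ioc m n with p.Prime, g p := by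
  rw [sub_eq_iff_eq_add', ← Finset.sum_union]
  · refine Finset.sum_congr ?_ fun _ _ => rfl
    ext p
    simp only [Nat.mem_primesLE, Finset.mem_union, Finset.mem_filter, Finset.mem_Ioc]
    grind
  · rw [Finset.disjoint_left]
    intro p hp hp'
    simp only [Nat.mem_primesLE, Finset.mem_filter, Finset.mem_Ioc] at hp hp'
    omega

theorem log_pos_of_mem_Icc {a b x : ℝ} (ha : 1 < a) (hx : x ∈ Set.Icc a b) : 0 < Real.log x :=
  Real.log_pos (ha.trans_le hx.1)

theorem continuousOn_log_Icc {a b : ℝ} (ha : 1 < a) : ContinuousOn Real.log (Set.Icc a b) :=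
  Real.continuousOn_log.mono fun x hx => by
    simp only [Set.mem_compl_iff, Set.mem_singleton_iff]; linarith [hx.1]

theorem hasDerivAt_log_log {x : ℝ} (hx : 1 < x) :
    HasDerivAt (fun y => Real.log (Real.log y)) (1 / (x * Real.log x)) x := by
  have hl := Real.log_pos hx
  refine ((Real.hasDerivAt_log (by linarith)).log hl.ne').congr_deriv ?_
  field_simp

/-- The second theorem of Mertens. -/
theorem exists_abs_sum_prime_inv_sub_log_log_le :
    ∃ B K : ℝ, 0 < K ∧ ∀ n : ℕ, 2 ≤ n →
      |∑ p ∈ Nat.primesLE n, (1 / p : ℝ) - Real.log (Real.log n) - B| ≤ K / Real.log n := by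
  obtain ⟨M, hM, h⟩ := exists_norm_sum_log_div_prime_mul_sub_le
  set D : ℕ → ℝ := fun n => ∑ p ∈ Nat.primesLE n, (1 / p : ℝ) - Real.log (Real.log n)
  -- Partial summation with weight `1 / log x`: the boundary terms and the variation add up to `1 /
  -- log m + 1 / log n + (1 / log m - 1 / log n)`. The bound gives both the existence of the limit
  -- `B` and the rate of convergence.
  have hD : ∀ m n : ℕ, 2 ≤ m → m ≤ n → |D n - D m| ≤ 2 * M / Real.log m := by
    intro m n hm hmn
    have hm' : (1 : ℝ) < m := by exact_mod_cast (by omega : 1 < m)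
    have hmn' : (m : ℝ) ≤ n := by exact_mod_cast hmn
    have hd : ∀ x ∈ Set.Icc (m : ℝ) n,
        HasDerivAt (fun y => 1 / Real.log y) (-(1 / (x * Real.log x ^ 2))) x := by
      intro x hx
      have hl := log_pos_of_mem_Icc hm' hx
      have hx0 : 0 < x := by linarith [hx.1]
      refine ((hasDerivAt_const x (1 : ℝ)).div (Real.hasDerivAt_log hx0.ne') hl.ne').congr_deriv ?_
      field_simp
      ring
    have hc : ContinuousOn (fun x : ℝ => 1 / (x * Real.log x ^ 2)) (Set.Icc (m : ℝ) n) := by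
      refine continuousOn_const.div (continuousOn_id.mul ((continuousOn_log_Icc hm').pow 2)) ?_
      intro x hx
      have hl := log_pos_of_mem_Icc hm' hx
      have hx0 : 0 < x := by linarith [hx.1]
      exact (mul_pos hx0 (pow_pos hl 2)).ne'
    have key := h m n (fun x => ((1 / Real.log x : ℝ) : ℂ))
      (fun x => ((-(1 / (x * Real.log x ^ 2)) : ℝ) : ℂ))
      (fun x => ((Real.log (Real.log x) : ℝ) : ℂ)) (fun x => -(1 / Real.log x))
      (fun x => 1 / (x * Real.log x ^ 2)) hm' hmn' (fun x hx => (hd x hx).ofReal_comp)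
      (fun x hx => ((hasDerivAt_log_log (hm'.trans_le hx.1)).ofReal_comp).congr_deriv
        (by push_cast; rw [mul_comm, div_div]))
      (fun x hx => (hd x hx).fun_neg.congr_deriv (neg_neg _))
      (Complex.continuous_ofReal.comp_continuousOn hc.neg) hc
      (fun x hx => by
        have hl := log_pos_of_mem_Icc hm' hx
        have hx0 : 0 < x := by linarith [hx.1]
        rw [Complex.norm_real, norm_neg, Real.norm_of_nonneg (by positivity)])
    have hlm := Real.log_pos hm'
    have hln := Real.log_pos (hm'.trans_le hmn')
    have hs : ∑ p ∈ Finset.Ioc ⌊(m : ℝ)⌋₊ ⌊(n : ℝ)⌋₊ with p.Prime,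
        (((1 / Real.log p : ℝ) : ℂ)) * (Real.log p / p) =
        ((∑ p ∈ Nat.primesLE n, (1 / p : ℝ) - ∑ p ∈ Nat.primesLE m, (1 / p : ℝ) : ℝ) : ℂ) := by
      rw [sum_primesLE_sub_sum_primesLE _ hmn, Nat.floor_natCast, Nat.floor_natCast,
        Complex.ofReal_sum]
      refine Finset.sum_congr rfl fun p hp => ?_
      have hp1 : (1 : ℝ) < p := by exact_mod_cast (Finset.mem_filter.1 hp).2.one_lt
      have hl : ((Real.log p : ℝ) : ℂ) ≠ 0 := by exact_mod_cast (Real.log_pos hp1).ne'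
      simp only [Complex.ofReal_div, Complex.ofReal_one, Complex.ofReal_natCast]
      field_simp
    rw [hs, ← Complex.ofReal_sub, ← Complex.ofReal_sub, Complex.norm_real, Complex.norm_real,
      Complex.norm_real, Real.norm_of_nonneg (one_div_pos.2 hlm).le,
      Real.norm_of_nonneg (one_div_pos.2 hln).le, Real.norm_eq_abs] at key
    calc |D n - D m| = _ := by simp only [D]; congr 1; ring
      _ ≤ _ := key
      _ = _ := by ring
  have hlim : Filter.Tendsto (fun n : ℕ => 2 * M / Real.log ((n + 2 : ℕ) : ℝ)) Filter.atTop
      (nhds 0) := by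
    refine tendsto_const_nhds.div_atTop (Real.tendsto_log_atTop.comp ?_)
    exact tendsto_natCast_atTop_atTop.comp (Filter.tendsto_add_atTop_nat 2)
  have hcs : CauchySeq fun n => D (n + 2) := by
    refine cauchySeq_of_le_tendsto_0' _ (fun n m hnm => ?_) hlim
    rw [dist_comm, Real.dist_eq]
    exact hD (n + 2) (m + 2) (by omega) (by omega)
  obtain ⟨B, hB⟩ := cauchySeq_tendsto_of_complete hcs
  refine ⟨B, 2 * M, by positivity, fun n hn => ?_⟩
  have h1 : Filter.Tendsto (fun m => |D (m + 2) - D n|) Filter.atTop (nhds |B - D n|) :=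
    (hB.sub_const _).abs
  rw [abs_sub_comm]
  refine le_of_tendsto h1 ?_
  filter_upwards [Filter.eventually_ge_atTop n] with m hm
  exact hD n (m + 2) hn (by omega)

/-! ### Growth of the exponent and size of `dickmanChar`. -/

/-- The integral `∫₀¹ (e^{itv} - 1) / v dv` in the exponent of `dickmanChar`. -/
noncomputable def dickmanExponent (t : ℝ) : ℂ :=
  ∫ v in (0 : ℝ)..1, (Complex.exp (Complex.I * t * v) - 1) / (v : ℂ)

theorem dickmanChar_eq_exp (α : ℂ) (t : ℝ) :
    dickmanChar α t = Complex.exp (α * dickmanExponent t) := rfl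

/-- The continuous extension of `(e^{is} - 1) / s` to `s = 0`. -/
noncomputable def expSlope : ℝ → ℂ := dslope (fun s : ℝ => Complex.exp (Complex.I * s)) 0

theorem hasDerivAt_exp_I_mul (c x : ℝ) :
    HasDerivAt (fun s : ℝ => Complex.exp (Complex.I * (c * s : ℝ)))
      (Complex.I * c * Complex.exp (Complex.I * (c * x : ℝ))) x := by
  have h : HasDerivAt (fun s : ℝ => Complex.I * ((c * s : ℝ) : ℂ)) (Complex.I * ((c * 1 : ℝ) : ℂ)) x :=
    (((hasDerivAt_id x).const_mul c).ofReal_comp).const_mul _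
  refine h.cexp.congr_deriv ?_
  push_cast; ring

theorem expSlope_of_ne {s : ℝ} (hs : s ≠ 0) :
    expSlope s = (Complex.exp (Complex.I * s) - 1) / s := by
  rw [expSlope, dslope_of_ne _ hs, slope_def_module]
  simp [div_eq_inv_mul]

theorem mul_expSlope (s : ℝ) : s * expSlope s = Complex.exp (Complex.I * s) - 1 := by
  rcases eq_or_ne s 0 with rfl | hs
  · simp
  · rw [expSlope_of_ne hs]
    have : (s : ℂ) ≠ 0 := by exact_mod_cast hs
    field_simp

theorem continuous_expSlope : Continuous expSlope := by
  rw [← continuousOn_univ, expSlope, continuousOn_dslope Filter.univ_mem]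
  exact ⟨by fun_prop, by simpa using (hasDerivAt_exp_I_mul 1 0).differentiableAt⟩

theorem norm_expSlope_le (s : ℝ) : ‖expSlope s‖ ≤ 1 := by
  rcases eq_or_ne s 0 with rfl | hs
  · rw [expSlope, dslope_same]
    have := (hasDerivAt_exp_I_mul 1 0).deriv
    simp only [one_mul] at this
    rw [this]; simp
  · rw [expSlope_of_ne hs, norm_div, Complex.norm_real, div_le_one (by positivity)]
    exact Real.norm_exp_I_mul_ofReal_sub_one_le

theorem dickmanExponent_eq_integral (t : ℝ) :
    dickmanExponent t = ∫ s in (0 : ℝ)..t, expSlope s := by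
  have h := intervalIntegral.smul_integral_comp_mul_left (a := 0) (b := 1) expSlope t
  rw [mul_zero, mul_one] at h
  rw [← h, ← intervalIntegral.integral_smul, dickmanExponent]
  refine intervalIntegral.integral_congr_ae (Filter.Eventually.of_forall fun v hv => ?_)
  rw [Set.uIoc_of_le zero_le_one] at hv
  have hv0 : (v : ℂ) ≠ 0 := by exact_mod_cast hv.1.ne'
  have h1 := mul_expSlope (t * v)
  rw [div_eq_iff hv0, Complex.real_smul]
  push_cast at h1
  rw [mul_assoc Complex.I, ← h1]; ring

theorem hasDerivAt_dickmanExponent (t : ℝ) : HasDerivAt dickmanExponent (expSlope t) t := by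
  rw [funext dickmanExponent_eq_integral]
  exact (continuous_expSlope.integral_hasStrictDerivAt 0 t).hasDerivAt

theorem norm_dickmanExponent_le (t : ℝ) : ‖dickmanExponent t‖ ≤ |t| := by
  rw [dickmanExponent_eq_integral]
  simpa using intervalIntegral.norm_integral_le_of_norm_le_const (a := 0) (b := t)
    (fun x _ => norm_expSlope_le x)

theorem dickmanExponent_neg (t : ℝ) :
    dickmanExponent (-t) = (starRingEnd ℂ) (dickmanExponent t) := by
  rw [dickmanExponent, dickmanExponent, intervalIntegral.integral_of_le zero_le_one,
    intervalIntegral.integral_of_le zero_le_one, ← integral_conj]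
  congr 1; ext v
  simp only [map_div₀, map_sub, map_one, Complex.conj_ofReal, ← Complex.exp_conj, map_mul,
    Complex.conj_I]
  push_cast; ring_nf

/-- The derivative of the sum inside the norm is `e^{is} / s`, not absolutely integrable at
infinity. Subtracting `e^{is} / (is)`, as in one integration by parts, leaves `e^{is} / (i s²)`,
whose integral over `[1, y]` is at most `1`. -/
theorem norm_dickmanExponent_add_log_le_of_one_le {y : ℝ} (hy : 1 ≤ y) :
    ‖dickmanExponent y + Real.log y‖ ≤ 4 := by
  set D : ℝ → ℂ := fun s => dickmanExponent s + Real.log s -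
    Complex.exp (Complex.I * (1 * s : ℝ)) / (Complex.I * s)
  set D' : ℝ → ℂ := fun s => Complex.exp (Complex.I * s) / (Complex.I * s ^ 2)
  have hI : Set.uIcc 1 y = Set.Icc 1 y := Set.uIcc_of_le hy
  have hD : ∀ s ∈ Set.uIcc 1 y, HasDerivAt D (D' s) s := by
    intro s hs
    rw [hI] at hs
    have hs0 : s ≠ 0 := by linarith [hs.1]
    have hs0' : (s : ℂ) ≠ 0 := by exact_mod_cast hs0
    have h1 : HasDerivAt (fun y : ℝ => ((Real.log y : ℝ) : ℂ)) ((s⁻¹ : ℝ) : ℂ) s :=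
      (Real.hasDerivAt_log hs0).ofReal_comp
    have h2 : HasDerivAt (fun s : ℝ => Complex.I * (s : ℂ)) (Complex.I * ((1 : ℝ) : ℂ)) s :=
      ((hasDerivAt_id s).ofReal_comp).const_mul _
    have h3 := (hasDerivAt_exp_I_mul 1 s).div h2 (mul_ne_zero Complex.I_ne_zero hs0')
    refine (((hasDerivAt_dickmanExponent s).add h1).sub h3).congr_deriv ?_
    simp only [D', expSlope_of_ne hs0]
    push_cast
    field_simp
    ring
  have hc : ContinuousOn D' (Set.Icc 1 y) := by
    refine ContinuousOn.div (by fun_prop) (by fun_prop) fun s hs => ?_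
    have hs0' : (s : ℂ) ≠ 0 := by exact_mod_cast (by linarith [hs.1] : s ≠ 0)
    simp [hs0']
  have hint := intervalIntegral.integral_eq_sub_of_hasDerivAt hD
    (ContinuousOn.intervalIntegrable (by rwa [hI]))
  have hg : ∀ s ∈ Set.uIcc 1 y, HasDerivAt (fun s : ℝ => -s⁻¹) (1 / s ^ 2) s := by
    intro s hs
    rw [hI] at hs
    refine (hasDerivAt_inv (by linarith [hs.1])).neg.congr_deriv ?_
    simp
  have hgc : IntervalIntegrable (fun s : ℝ => 1 / s ^ 2) MeasureTheory.volume 1 y := by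
    refine ContinuousOn.intervalIntegrable ?_
    rw [hI]
    refine continuousOn_const.div (by fun_prop) fun s hs => ?_
    exact pow_ne_zero _ (by linarith [hs.1])
  have hle : ‖D y - D 1‖ ≤ 1 := by
    rw [← hint]
    refine (intervalIntegral.norm_integral_le_of_norm_le hy
      (Filter.Eventually.of_forall fun s hs => ?_) hgc).trans ?_
    · simp only [D', norm_div, norm_mul, Complex.norm_I, one_mul, norm_pow, Complex.norm_real,
        Complex.norm_exp_I_mul_ofReal, Real.norm_eq_abs, sq_abs, le_refl]
    · rw [intervalIntegral.integral_eq_sub_of_hasDerivAt hg hgc]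
      have : 0 < y⁻¹ := by positivity
      norm_num
      linarith
  have hE : ∀ s : ℝ, 1 ≤ s → ‖Complex.exp (Complex.I * (1 * s : ℝ)) / (Complex.I * s)‖ ≤ 1 := by
    intro s hs
    rw [norm_div, Complex.norm_exp_I_mul_ofReal, norm_mul, Complex.norm_I, one_mul,
      Complex.norm_real, Real.norm_eq_abs]
    exact div_le_one_of_le₀ (hs.trans (le_abs_self s)) (abs_nonneg s)
  have hD1 : ‖D 1‖ ≤ 2 := by
    have h1 := norm_dickmanExponent_le 1
    have h2 := hE 1 le_rfl
    simp only [D, Real.log_one, Complex.ofReal_zero, add_zero]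
    refine (norm_sub_le _ _).trans ?_
    rw [abs_one] at h1
    linarith
  calc ‖dickmanExponent y + Real.log y‖
      = ‖(D y - D 1) + D 1 + Complex.exp (Complex.I * (1 * y : ℝ)) / (Complex.I * y)‖ := by
        congr 1; simp only [D]; ring
    _ ≤ 1 + 2 + 1 := (norm_add_le _ _).trans
        (add_le_add ((norm_add_le _ _).trans (add_le_add hle hD1)) (hE y hy))
    _ = 4 := by norm_num

/-- Near `0` both terms are bounded, beyond `1` the shift in the logarithm costs at most `log 2`,
and negative arguments follow by conjugation. -/
theorem norm_dickmanExponent_add_log_one_add_abs_le (y : ℝ) :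
    ‖dickmanExponent y + Real.log (1 + |y|)‖ ≤ 5 := by
  have hl2 : Real.log 2 ≤ 1 := by linarith [Real.log_two_lt_d9]
  wlog hy : 0 ≤ y generalizing y
  · have h := this (-y) (by linarith)
    rw [dickmanExponent_neg, abs_neg] at h
    rw [← Complex.norm_conj] at h
    simpa only [map_add, Complex.conj_conj, Complex.conj_ofReal] using h
  rw [abs_of_nonneg hy]
  rcases le_total y 1 with h1 | h1
  · have h2 := norm_dickmanExponent_le y
    rw [abs_of_nonneg hy] at h2
    have h3 : Real.log (1 + y) ≤ Real.log 2 := Real.log_le_log (by linarith) (by linarith)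
    have h4 : 0 ≤ Real.log (1 + y) := Real.log_nonneg (by linarith)
    refine (norm_add_le _ _).trans ?_
    rw [Complex.norm_real, Real.norm_of_nonneg h4]
    linarith
  · have h2 := norm_dickmanExponent_add_log_le_of_one_le h1
    have h3 : Real.log (1 + y) ≤ Real.log 2 + Real.log y := by
      rw [← Real.log_mul (by norm_num) (by linarith)]
      exact Real.log_le_log (by linarith) (by linarith)
    have h4 : Real.log y ≤ Real.log (1 + y) := Real.log_le_log (by linarith) (by linarith)
    calc ‖dickmanExponent y + Real.log (1 + y)‖
        = ‖(dickmanExponent y + Real.log y) + ((Real.log (1 + y) - Real.log y : ℝ) : ℂ)‖ := by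
          congr 1; push_cast; ring
      _ ≤ 4 + 1 := by
          refine (norm_add_le _ _).trans (add_le_add h2 ?_)
          rw [Complex.norm_real, Real.norm_of_nonneg (by linarith)]; linarith
      _ = 5 := by norm_num

theorem continuous_dickmanChar (α : ℂ) : Continuous (dickmanChar α) := by
  have : Continuous dickmanExponent :=
    continuous_iff_continuousAt.2 fun t => (hasDerivAt_dickmanExponent t).continuousAt
  rw [funext (dickmanChar_eq_exp α)]
  fun_prop

/-- The exponent is the real number `-log (1 + |t|)` up to an error of norm at most `5`, so only
`α.re` enters the power. -/
theorem norm_dickmanChar_le (α : ℂ) (t : ℝ) :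
    ‖dickmanChar α t‖ ≤ Real.exp (5 * ‖α‖) * (1 + |t|) ^ (-α.re) := by
  have h0 : 0 < 1 + |t| := by positivity
  rw [dickmanChar_eq_exp, Complex.norm_exp, Real.rpow_def_of_pos h0, ← Real.exp_add]
  refine Real.exp_le_exp.2 ?_
  have h1 : α * dickmanExponent t =
      α * (dickmanExponent t + Real.log (1 + |t|)) - α * (Real.log (1 + |t|) : ℝ) := by ring
  have h2 : (α * (dickmanExponent t + Real.log (1 + |t|))).re ≤ 5 * ‖α‖ := by
    refine (Complex.re_le_norm _).trans ?_
    rw [norm_mul, mul_comm]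
    gcongr
    exact norm_dickmanExponent_add_log_one_add_abs_le t
  rw [h1, Complex.sub_re, Complex.re_mul_ofReal]
  linarith

/-! ### Oscillating sums over primes. -/

/-- The sums `∑ (p^{it} - 1) / p` over the primes `p ≤ N`. -/
theorem exists_norm_sum_prime_exp_sub_dickmanExponent_le :
    ∃ K : ℝ, 0 < K ∧ ∀ (N : ℕ) (t : ℝ), 2 ≤ N → 0 ≤ Real.log (Real.log N) →
      ‖∑ p ∈ Nat.primesLE N, (Complex.exp (Complex.I * (t * Real.log p : ℝ)) - 1) / p -
        dickmanExponent (t * Real.log N)‖ ≤ K * |t| * (1 + Real.log (Real.log N)) := by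
  obtain ⟨M, hM, h⟩ := exists_norm_sum_log_div_prime_mul_sub_le
  refine ⟨4 * M + 2, by positivity, fun N t hN hll => ?_⟩
  have hN' : (2 : ℝ) ≤ N := by exact_mod_cast hN
  set e : ℝ → ℂ := fun x => Complex.exp (Complex.I * (t * Real.log x : ℝ))
  have hen : ∀ x, ‖e x‖ = 1 := fun x => Complex.norm_exp_I_mul_ofReal _
  have he1 : ∀ x, 1 < x → ‖e x - 1‖ ≤ |t| * Real.log x := fun x hx => by
    have := Real.norm_exp_I_mul_ofReal_sub_one_le (x := t * Real.log x)
    rwa [Real.norm_eq_abs, abs_mul, abs_of_pos (Real.log_pos hx)] at this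
  -- The weight is bounded by `|t|` and its derivative by `2 |t| / (x log x)`. Integrating the
  -- latter gives the factor `log log N`, which is where the cutoff `log N / log log N` originates.
  set W : ℝ → ℂ := fun x => (e x - 1) / (Real.log x : ℝ)
  set W' : ℝ → ℂ := fun x => Complex.I * t * e x / (x * Real.log x : ℝ) -
    (e x - 1) / (x * Real.log x ^ 2 : ℝ)
  set V : ℝ → ℂ := fun x => dickmanExponent (t * Real.log x)
  have hW : ∀ x ∈ Set.Icc (2 : ℝ) N, HasDerivAt W (W' x) x := by
    intro x hx
    have hl := log_pos_of_mem_Icc one_lt_two hx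
    have hx0 : x ≠ 0 := by linarith [hx.1]
    have hx0' : (x : ℂ) ≠ 0 := by exact_mod_cast hx0
    have hl' : ((Real.log x : ℝ) : ℂ) ≠ 0 := by exact_mod_cast hl.ne'
    have hlog := Real.hasDerivAt_log hx0
    have h1 : HasDerivAt e (x⁻¹ • (Complex.I * t * e x)) x :=
      (hasDerivAt_exp_I_mul t (Real.log x)).scomp x hlog
    refine ((h1.sub_const 1).div hlog.ofReal_comp hl').congr_deriv ?_
    simp only [W', Complex.real_smul]
    push_cast
    field_simp
  have hWn : ∀ x, 1 < x → ‖W x‖ ≤ |t| := fun x hx => by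
    have hl := Real.log_pos hx
    rw [norm_div, Complex.norm_real, Real.norm_of_nonneg hl.le, div_le_iff₀ hl]
    exact he1 x hx
  have hV : ∀ x ∈ Set.Icc (2 : ℝ) N, HasDerivAt V (W x / x) x := by
    intro x hx
    have hl := log_pos_of_mem_Icc one_lt_two hx
    have hx0 : x ≠ 0 := by linarith [hx.1]
    have hx0' : (x : ℂ) ≠ 0 := by exact_mod_cast hx0
    have hl' : ((Real.log x : ℝ) : ℂ) ≠ 0 := by exact_mod_cast hl.ne'
    refine ((hasDerivAt_dickmanExponent (t * Real.log x)).scomp x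
      ((Real.hasDerivAt_log hx0).const_mul t)).congr_deriv ?_
    have h1 := mul_expSlope (t * Real.log x)
    simp only [W, e, ← h1, Complex.real_smul]
    push_cast
    field_simp
  have hlc := continuousOn_log_Icc (a := 2) (b := N) one_lt_two
  have hec : ContinuousOn e (Set.Icc (2 : ℝ) N) := by
    have : Continuous fun y : ℝ => Complex.exp (Complex.I * (t * y : ℝ)) := by fun_prop
    exact this.comp_continuousOn hlc
  have hW'c : ContinuousOn W' (Set.Icc (2 : ℝ) N) := by
    refine ContinuousOn.sub (ContinuousOn.div (by fun_prop)
      (Complex.continuous_ofReal.comp_continuousOn (continuousOn_id.mul hlc)) ?_)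
      (ContinuousOn.div (by fun_prop)
      (Complex.continuous_ofReal.comp_continuousOn (continuousOn_id.mul (hlc.pow 2))) ?_)
    all_goals
      intro x hx
      have hl := log_pos_of_mem_Icc one_lt_two hx
      have hx0 : x ≠ 0 := by linarith [hx.1]
      refine Complex.ofReal_ne_zero.2 (mul_ne_zero hx0 ?_)
      positivity
  have hG'c : ContinuousOn (fun x : ℝ => 2 * |t| * (1 / (x * Real.log x))) (Set.Icc (2 : ℝ) N) := by
    refine continuousOn_const.mul (continuousOn_const.div (continuousOn_id.mul hlc) fun x hx => ?_)
    have hl := log_pos_of_mem_Icc one_lt_two hx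
    exact mul_ne_zero (show x ≠ 0 by linarith [hx.1]) hl.ne'
  have key := h 2 N W W' V (fun x => 2 * |t| * Real.log (Real.log x))
    (fun x => 2 * |t| * (1 / (x * Real.log x))) one_lt_two hN' hW hV
    (fun x hx => (hasDerivAt_log_log (one_lt_two.trans_le hx.1)).const_mul _) hW'c hG'c
    (fun x hx => by
      have hl := log_pos_of_mem_Icc one_lt_two hx
      have hx0 : 0 < x := by linarith [hx.1]
      have h1 : ‖Complex.I * t * e x / (x * Real.log x : ℝ)‖ ≤ |t| * (1 / (x * Real.log x)) := by
        rw [norm_div, norm_mul, norm_mul, hen, Complex.norm_I, Complex.norm_real,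
          Complex.norm_real, Real.norm_of_nonneg (by positivity : 0 ≤ x * Real.log x),
          Real.norm_eq_abs]
        apply le_of_eq; ring
      have h2 : ‖(e x - 1) / (x * Real.log x ^ 2 : ℝ)‖ ≤ |t| * (1 / (x * Real.log x)) := by
        rw [norm_div, Complex.norm_real, Real.norm_of_nonneg (by positivity)]
        calc _ ≤ |t| * Real.log x / (x * Real.log x ^ 2) := by
              gcongr; exact he1 x (by linarith [hx.1])
          _ = _ := by field_simp
      calc _ ≤ _ := norm_sub_le _ _
        _ ≤ _ := add_le_add h1 h2
        _ = _ := by ring)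
  have hsplit := sum_primesLE_sub_sum_primesLE (fun p : ℕ => (e p - 1) / (p : ℂ)) hN
  -- Partial summation covers only the primes above `2`; the term of the prime `2` is estimated by
  -- itself.
  have hp2 : Nat.primesLE 2 = {2} := by decide
  rw [hp2, Finset.sum_singleton] at hsplit
  have hs : ∑ p ∈ Finset.Ioc ⌊(2 : ℝ)⌋₊ ⌊(N : ℝ)⌋₊ with p.Prime, W p * (Real.log p / p) =
      ∑ p ∈ Finset.Ioc 2 N with p.Prime, (e p - 1) / (p : ℂ) := by
    rw [Nat.floor_natCast, Nat.floor_ofNat]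
    refine Finset.sum_congr rfl fun p hp => ?_
    have hp1 : (1 : ℝ) < p := by exact_mod_cast (Finset.mem_filter.1 hp).2.one_lt
    have hl : ((Real.log p : ℝ) : ℂ) ≠ 0 := by exact_mod_cast (Real.log_pos hp1).ne'
    simp only [W]
    field_simp
  rw [hs, ← hsplit] at key
  have hl2 : Real.log 2 ≤ 1 := by linarith [Real.log_two_lt_d9]
  have hll2 : -1 ≤ Real.log (Real.log 2) := by
    have h1 : Real.exp (-1) ≤ Real.log 2 := by
      have := Real.exp_neg_one_lt_d9
      linarith [Real.log_two_gt_d9]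
    rw [Real.le_log_iff_exp_le (Real.log_pos one_lt_two)]
    exact h1
  have hV2 : ‖V 2‖ ≤ |t| := by
    refine (norm_dickmanExponent_le _).trans ?_
    rw [abs_mul, abs_of_pos (Real.log_pos one_lt_two)]
    exact mul_le_of_le_one_right (abs_nonneg t) hl2
  have he2 : ‖(e (2 : ℕ) - 1) / ((2 : ℕ) : ℂ)‖ ≤ |t| := by
    rw [norm_div]
    have := he1 (2 : ℕ) (by norm_num)
    have h3 : |t| * Real.log (2 : ℕ) ≤ |t| := by
      push_cast; exact mul_le_of_le_one_right (abs_nonneg t) hl2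
    have h4 : ‖((2 : ℕ) : ℂ)‖ = 2 := by simp
    rw [h4, div_le_iff₀ (by norm_num)]
    linarith [abs_nonneg t]
  have hW2 := hWn 2 one_lt_two
  have hWN := hWn N (by linarith)
  have ht := abs_nonneg t
  set S := ∑ p ∈ Nat.primesLE N, (e p - 1) / (p : ℂ)
  calc ‖S - V N‖ = ‖(S - (e (2 : ℕ) - 1) / ((2 : ℕ) : ℂ) - (V N - V 2)) +
        ((e (2 : ℕ) - 1) / ((2 : ℕ) : ℂ) - V 2)‖ := by congr 1; ring
    _ ≤ M * (‖W 2‖ + ‖W N‖ + (2 * |t| * Real.log (Real.log N) - 2 * |t| * Real.log (Real.log 2))) +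
        (|t| + |t|) := (norm_add_le _ _).trans (add_le_add key
          ((norm_sub_le _ _).trans (add_le_add he2 hV2)))
    _ ≤ M * (|t| + |t| + (2 * |t| * Real.log (Real.log N) + 2 * |t|)) + (|t| + |t|) := by
        gcongr
        nlinarith
    _ ≤ (4 * M + 2) * |t| * (1 + Real.log (Real.log N)) := by
        nlinarith [mul_nonneg ht hll, mul_nonneg hM.le (mul_nonneg ht hll)]

/-! ### Second order terms of the Euler factors. -/

/-- The function `h` with `1 + z + ⋯ + z ^ (k - 1) = exp (z + h z)` on the unit disc. -/
noncomputable def geomLogRemainder (k : ℕ) (z : ℂ) : ℂ :=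
  Complex.log (1 - z ^ k) - Complex.log (1 - z) - z

theorem one_sub_mem_slitPlane {z : ℂ} (hz : ‖z‖ < 1) : 1 - z ∈ Complex.slitPlane := by
  refine Or.inl ?_
  have := Complex.re_le_norm z
  simp only [Complex.sub_re, Complex.one_re]
  linarith

theorem exp_add_geomLogRemainder {k : ℕ} (hk : k ≠ 0) {z : ℂ} (hz : ‖z‖ < 1) :
    Complex.exp (z + geomLogRemainder k z) = ∑ j ∈ Finset.range k, z ^ j := by
  have hzk : ‖z ^ k‖ < 1 := by rw [norm_pow]; exact pow_lt_one₀ (norm_nonneg z) hz hk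
  have h1 := Complex.slitPlane_ne_zero (one_sub_mem_slitPlane hz)
  have h2 := Complex.slitPlane_ne_zero (one_sub_mem_slitPlane hzk)
  have h3 : z + geomLogRemainder k z = Complex.log (1 - z ^ k) - Complex.log (1 - z) := by
    rw [geomLogRemainder]; ring
  rw [h3, Complex.exp_sub, Complex.exp_log h1, Complex.exp_log h2, div_eq_iff h1,
    geom_sum_mul_neg]

theorem geomLogRemainder_zero {k : ℕ} (hk : k ≠ 0) : geomLogRemainder k 0 = 0 := by
  simp [geomLogRemainder, hk]

theorem hasDerivAt_geomLogRemainder {k : ℕ} (hk : k ≠ 0) {z : ℂ} (hz : ‖z‖ < 1) :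
    HasDerivAt (geomLogRemainder k) (z / (1 - z) - k * z ^ (k - 1) / (1 - z ^ k)) z := by
  have hzk : ‖z ^ k‖ < 1 := by rw [norm_pow]; exact pow_lt_one₀ (norm_nonneg z) hz hk
  have h1 : HasDerivAt (fun z : ℂ => 1 - z) (-1) z := by
    simpa using (hasDerivAt_id z).const_sub 1
  have h2 : HasDerivAt (fun z : ℂ => 1 - z ^ k) (-(k * z ^ (k - 1))) z :=
    (hasDerivAt_pow k z).const_sub 1
  refine (((h2.clog (one_sub_mem_slitPlane hzk)).sub
    (h1.clog (one_sub_mem_slitPlane hz))).sub (hasDerivAt_id z)).congr_deriv ?_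
  have h3 := Complex.slitPlane_ne_zero (one_sub_mem_slitPlane hz)
  field_simp
  ring

/-- For `k ≥ 2` the derivative vanishes at `0`, so it is `O(r)` on the disc of radius `r`. With `r =
‖α‖ / p` the extra factor gives the convergent `1 / p²`; `ρ = ‖α‖ / 2 < 1` keeps the denominators
away from `0` for all primes at once. -/
theorem norm_geomLogRemainder_sub_le {k : ℕ} (hk : 2 ≤ k) {ρ r : ℝ} (hρ : ρ < 1) (hr : r ≤ ρ)
    {z w : ℂ} (hz : ‖z‖ ≤ r) (hw : ‖w‖ ≤ r) :
    ‖geomLogRemainder k z - geomLogRemainder k w‖ ≤ (k + 1) * r / (1 - ρ) * ‖z - w‖ := by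
  have hk0 : k ≠ 0 := by omega
  have hr0 : 0 ≤ r := (norm_nonneg z).trans hz
  refine (convex_closedBall (0 : ℂ) r).norm_image_sub_le_of_norm_hasDerivWithin_le
    (f := geomLogRemainder k) (f' := fun z => z / (1 - z) - k * z ^ (k - 1) / (1 - z ^ k))
    (fun x hx => (hasDerivAt_geomLogRemainder hk0 ?_).hasDerivWithinAt) (fun x hx => ?_)
    (mem_closedBall_zero_iff.2 hw) (mem_closedBall_zero_iff.2 hz)
  · linarith [mem_closedBall_zero_iff.1 hx]
  have hx' : ‖x‖ ≤ r := mem_closedBall_zero_iff.1 hx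
  have hρ' : 0 < 1 - ρ := by linarith
  have hx1 : ‖x‖ ≤ 1 := by linarith
  have h1 : 1 - ρ ≤ ‖1 - x‖ := by
    have := norm_sub_norm_le (1 : ℂ) x
    rw [norm_one] at this; linarith
  have h2 : 1 - ρ ≤ ‖1 - x ^ k‖ := by
    have := norm_sub_norm_le (1 : ℂ) (x ^ k)
    have h3 : ‖x‖ ^ k ≤ ‖x‖ := pow_le_of_le_one (norm_nonneg x) hx1 hk0
    rw [norm_one, norm_pow] at this; linarith
  have h3 : ‖x ^ (k - 1)‖ ≤ r := by
    rw [norm_pow]; exact (pow_le_of_le_one (norm_nonneg x) hx1 (by omega)).trans hx'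
  have h4 : ‖x / (1 - x)‖ ≤ r / (1 - ρ) := by
    rw [norm_div]; gcongr
  have h5 : ‖k * x ^ (k - 1) / (1 - x ^ k)‖ ≤ k * r / (1 - ρ) := by
    rw [norm_div, norm_mul, Complex.norm_natCast]; gcongr
  calc _ ≤ _ := norm_sub_le _ _
    _ ≤ _ := add_le_add h4 h5
    _ = _ := by ring

/-! ### The Euler product and its asymptotics. -/

/-- The Euler factor product `∏_{p ≤ N} (1 + z_p + ⋯ + z_p ^ (k - 1))` with
`z_p = α p ^ {it} / p`. -/
noncomputable def smoothEulerProduct (k : ℕ) (α : ℂ) (N : ℕ) (t : ℝ) : ℂ :=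
  ∏ p ∈ Nat.primesLE N, ∑ j ∈ Finset.range k,
    (α / p * Complex.exp (Complex.I * (t * Real.log p : ℝ))) ^ j

theorem norm_div_prime_le {α : ℂ} {p : ℕ} (hp : p.Prime) : ‖α / p‖ ≤ ‖α‖ / 2 := by
  have : (2 : ℝ) ≤ p := by exact_mod_cast hp.two_le
  rw [norm_div, Complex.norm_natCast]; gcongr

/-- The terms are `O(1 / p²)` by comparison with the value at `0`. In the tail the factor `log n /
log N ≥ 1` may be inserted, so the summability of `log n / n²` already gives the rate. -/
theorem exists_norm_sum_geomLogRemainder_sub_le {k : ℕ} (hk : 2 ≤ k) {α : ℂ} (hα : ‖α‖ < 2) :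
    ∃ (H : ℂ) (K : ℝ), 0 < K ∧ ∀ N : ℕ, 2 ≤ N →
      ‖∑ p ∈ Nat.primesLE N, geomLogRemainder k (α / p) - H‖ ≤ K / Real.log N := by
  set c := (k + 1) / (1 - ‖α‖ / 2) * ‖α‖ ^ 2
  have h1ρ : 0 < 1 - ‖α‖ / 2 := by linarith
  have hc : 0 ≤ c := by positivity
  set g : ℕ → ℂ := fun n => if n.Prime then geomLogRemainder k (α / n) else 0
  have hg : ∀ n, ‖g n‖ ≤ c * (1 / (n : ℝ) ^ 2) := by
    intro n
    simp only [g]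
    split_ifs with hn
    · have h := norm_geomLogRemainder_sub_le hk (ρ := ‖α‖ / 2) (by linarith)
        (norm_div_prime_le (α := α) hn) le_rfl (w := 0) (by rw [norm_zero]; positivity)
      rw [geomLogRemainder_zero (by omega), sub_zero, sub_zero, norm_div,
        Complex.norm_natCast] at h
      refine h.trans (le_of_eq ?_)
      simp only [c]
      field_simp
    · rw [norm_zero]; positivity
  have hgs : Summable g := Summable.of_norm_bounded
    ((Real.summable_one_div_nat_pow.2 one_lt_two).mul_left c) hg
  set T := ∑' n : ℕ, Real.log n / (n : ℝ) ^ 2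
  have hT : 0 ≤ T := tsum_nonneg fun n => by positivity
  refine ⟨∑' n, g n, c * T + 1, by positivity, fun N hN => ?_⟩
  have hN' : (1 : ℝ) < N := by exact_mod_cast (by omega : 1 < N)
  have hL := Real.log_pos hN'
  have hsum : ∑ p ∈ Nat.primesLE N, geomLogRemainder k (α / p) = ∑ n ∈ Finset.range (N + 1), g n := by
    rw [Nat.primesLE_eq_filter_range, Finset.sum_filter]
  have hpart : HasSum (fun n => if n ∈ Finset.range (N + 1) then g n else 0)
      (∑ n ∈ Finset.range (N + 1), g n) := by
    have hs : ∑ n ∈ Finset.range (N + 1), (if n ∈ Finset.range (N + 1) then g n else 0) =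
        ∑ n ∈ Finset.range (N + 1), g n := Finset.sum_congr rfl fun n hn => if_pos hn
    rw [← hs]
    exact hasSum_sum_of_ne_finset_zero fun n hn => if_neg hn
  have hgs' : HasSum g (∑' n, g n) := hgs.hasSum
  have hdiff := hgs'.sub hpart
  rw [hsum, norm_sub_rev, ← hdiff.tsum_eq]
  have hb := (summable_log_div_sq.hasSum.mul_left (c / Real.log N))
  refine (tsum_of_norm_bounded hb fun n => ?_).trans ?_
  · split_ifs with hn
    · rw [sub_self, norm_zero]; positivity
    · rw [sub_zero]
      rw [Finset.mem_range] at hn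
      have h1 : Real.log N ≤ Real.log n :=
        Real.log_le_log (by linarith) (by exact_mod_cast (by omega : N ≤ n))
      refine (hg n).trans ?_
      calc c * (1 / (n : ℝ) ^ 2) = c / Real.log N * (Real.log N / (n : ℝ) ^ 2) := by
            field_simp
        _ ≤ _ := by gcongr
  · rw [div_mul_eq_mul_div]
    gcongr
    linarith

/-- As `|p^{it} - 1| ≤ |t| log p`, each term is `O(|t| log p / p²)`, summable uniformly in `N`. -/
theorem exists_norm_sum_geomLogRemainder_exp_sub_le {k : ℕ} (hk : 2 ≤ k) {α : ℂ} (hα : ‖α‖ < 2) :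
    ∃ K : ℝ, 0 < K ∧ ∀ (N : ℕ) (t : ℝ),
      ‖∑ p ∈ Nat.primesLE N,
        (geomLogRemainder k (α / p * Complex.exp (Complex.I * (t * Real.log p : ℝ))) -
          geomLogRemainder k (α / p))‖ ≤ K * |t| := by
  set c := (k + 1) / (1 - ‖α‖ / 2) * ‖α‖ ^ 2
  have h1ρ : 0 < 1 - ‖α‖ / 2 := by linarith
  have hc : 0 ≤ c := by positivity
  set T := ∑' n : ℕ, Real.log n / (n : ℝ) ^ 2
  have hT : 0 ≤ T := tsum_nonneg fun n => by positivity
  refine ⟨c * T + 1, by positivity, fun N t => ?_⟩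
  have hterm : ∀ p ∈ Nat.primesLE N,
      ‖geomLogRemainder k (α / p * Complex.exp (Complex.I * (t * Real.log p : ℝ))) -
          geomLogRemainder k (α / p)‖ ≤ c * |t| * (Real.log p / (p : ℝ) ^ 2) := by
    intro p hp
    have hpp := Nat.prime_of_mem_primesLE hp
    have hp0 : (0 : ℝ) < p := by exact_mod_cast hpp.pos
    have h := norm_geomLogRemainder_sub_le hk (ρ := ‖α‖ / 2) (by linarith)
      (norm_div_prime_le (α := α) hpp)
      (z := α / p * Complex.exp (Complex.I * (t * Real.log p : ℝ))) (w := α / p)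
      (by rw [norm_mul, Complex.norm_exp_I_mul_ofReal, mul_one]) le_rfl
    have h2 := Real.norm_exp_I_mul_ofReal_sub_one_le (x := t * Real.log p)
    rw [Real.norm_eq_abs, abs_mul, abs_of_nonneg (Real.log_natCast_nonneg p)] at h2
    have h3 : α / p * Complex.exp (Complex.I * (t * Real.log p : ℝ)) - α / p =
      α / p * (Complex.exp (Complex.I * (t * Real.log p : ℝ)) - 1) := by ring
    rw [h3, norm_mul, norm_div, Complex.norm_natCast] at h
    calc _ ≤ _ := h
      _ ≤ (k + 1) * (‖α‖ / p) / (1 - ‖α‖ / 2) * (‖α‖ / p * (|t| * Real.log p)) := by gcongr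
      _ = _ := by simp only [c]; field_simp
  refine (norm_sum_le_of_le _ hterm).trans ?_
  rw [← Finset.mul_sum]
  have h1 : ∑ p ∈ Nat.primesLE N, Real.log p / (p : ℝ) ^ 2 ≤ T :=
    summable_log_div_sq.sum_le_tsum _ fun i _ => by positivity
  have ht := abs_nonneg t
  calc _ ≤ c * |t| * T := by gcongr
    _ ≤ _ := by nlinarith

/-- The asymptotic form of the Euler product. -/
theorem exists_smoothEulerProduct_eq {k : ℕ} (hk : 2 ≤ k) {α : ℂ} (hα : ‖α‖ < 2) :
    ∃ (C : ℂ) (K : ℝ), C ≠ 0 ∧ 0 < K ∧ ∀ (N : ℕ) (t : ℝ), 2 ≤ N → 0 ≤ Real.log (Real.log N) →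
      ∃ δ : ℂ, smoothEulerProduct k α N t =
          C * (Real.log N : ℂ) ^ α * dickmanChar α (t * Real.log N) * Complex.exp δ ∧
        ‖δ‖ ≤ K * (1 / Real.log N + |t| * (1 + Real.log (Real.log N))) := by
  obtain ⟨B, K₁, hK₁, h₁⟩ := exists_abs_sum_prime_inv_sub_log_log_le
  obtain ⟨K₂, hK₂, h₂⟩ := exists_norm_sum_prime_exp_sub_dickmanExponent_le
  obtain ⟨H, K₃, hK₃, h₃⟩ := exists_norm_sum_geomLogRemainder_sub_le hk hα
  obtain ⟨K₄, hK₄, h₄⟩ := exists_norm_sum_geomLogRemainder_exp_sub_le hk hα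
  -- `B` is the constant of Mertens' second theorem and `H` the limit of the second order terms at
  -- `t = 0`. As an exponential, `C` is nonzero.
  refine ⟨Complex.exp (α * B + H), ‖α‖ * K₁ + ‖α‖ * K₂ + K₃ + K₄, Complex.exp_ne_zero _,
    by positivity, fun N t hN hll => ?_⟩
  set e : ℕ → ℂ := fun p => Complex.exp (Complex.I * (t * Real.log p : ℝ))
  set δ₁ : ℝ := ∑ p ∈ Nat.primesLE N, (1 / p : ℝ) - Real.log (Real.log N) - B
  set δ₂ : ℂ := ∑ p ∈ Nat.primesLE N, (e p - 1) / p - dickmanExponent (t * Real.log N)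
  set δ₃ : ℂ := ∑ p ∈ Nat.primesLE N, geomLogRemainder k (α / p) - H
  set δ₄ : ℂ := ∑ p ∈ Nat.primesLE N,
    (geomLogRemainder k (α / p * e p) - geomLogRemainder k (α / p))
  have hN' : (1 : ℝ) < N := by exact_mod_cast (by omega : 1 < N)
  have hL := Real.log_pos hN'
  refine ⟨α * δ₁ + α * δ₂ + δ₃ + δ₄, ?_, ?_⟩
  · have hprod : smoothEulerProduct k α N t =
        Complex.exp (∑ p ∈ Nat.primesLE N, (α / p * e p + geomLogRemainder k (α / p * e p))) := by
      rw [smoothEulerProduct, Complex.exp_sum]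
      refine Finset.prod_congr rfl fun p hp => (exp_add_geomLogRemainder (by omega) ?_).symm
      rw [norm_mul, Complex.norm_exp_I_mul_ofReal, mul_one]
      linarith [norm_div_prime_le (α := α) (Nat.prime_of_mem_primesLE hp)]
    have hLc : ((Real.log N : ℝ) : ℂ) ≠ 0 := by exact_mod_cast hL.ne'
    rw [hprod, dickmanChar_eq_exp, Complex.cpow_def_of_ne_zero hLc, ← Complex.ofReal_log hL.le,
      ← Complex.exp_add, ← Complex.exp_add, ← Complex.exp_add]
    congr 1
    have hs : ∑ p ∈ Nat.primesLE N, α / p * e p = α * ((∑ p ∈ Nat.primesLE N, (1 / p : ℝ) : ℝ) : ℂ) +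
        α * ∑ p ∈ Nat.primesLE N, (e p - 1) / p := by
      push_cast
      rw [Finset.mul_sum, Finset.mul_sum, ← Finset.sum_add_distrib]
      exact Finset.sum_congr rfl fun p _ => by ring
    rw [Finset.sum_add_distrib, hs]
    simp only [δ₁, δ₂, δ₃, δ₄, Finset.sum_sub_distrib]
    push_cast
    ring
  · have hd1 := h₁ N hN
    have hd2 := h₂ N t hN hll
    have hd3 := h₃ N hN
    have hd4 := h₄ N t
    have e1 : ‖α * δ₁‖ ≤ ‖α‖ * (K₁ / Real.log N) := by
      rw [norm_mul, Complex.norm_real]; gcongr; exact hd1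
    have e2 : ‖α * δ₂‖ ≤ ‖α‖ * (K₂ * |t| * (1 + Real.log (Real.log N))) := by
      rw [norm_mul]; gcongr
    have ht := abs_nonneg t
    set u := 1 / Real.log N
    set v := |t| * (1 + Real.log (Real.log N))
    have hu : 0 ≤ u := by positivity
    have hv : 0 ≤ v := by positivity
    have htv : |t| ≤ v := le_mul_of_one_le_right ht (by linarith)
    calc ‖α * δ₁ + α * δ₂ + δ₃ + δ₄‖
        ≤ ‖α‖ * (K₁ / Real.log N) + ‖α‖ * (K₂ * |t| * (1 + Real.log (Real.log N))) +
          K₃ / Real.log N + K₄ * |t| :=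
          (norm_add_le _ _).trans (add_le_add ((norm_add_le _ _).trans (add_le_add
            ((norm_add_le _ _).trans (add_le_add e1 e2)) hd3)) hd4)
      _ = (‖α‖ * K₁) * u + (‖α‖ * K₂) * v + K₃ * u + K₄ * |t| := by simp only [u, v]; ring
      _ ≤ (‖α‖ * K₁) * (u + v) + (‖α‖ * K₂) * (u + v) + K₃ * (u + v) + K₄ * (u + v) := by
          gcongr <;> linarith
      _ = _ := by ring

/-- The Euler product at `t = 0` with positive coefficients, which majorizes all the others. -/
theorem exists_smoothEulerProduct_norm_le {k : ℕ} (hk : 2 ≤ k) {α : ℂ} (hα : ‖α‖ < 2) :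
    ∃ K : ℝ, 0 < K ∧ ∀ N : ℕ, 2 ≤ N → 0 ≤ Real.log (Real.log N) →
      ∏ p ∈ Nat.primesLE N, ∑ j ∈ Finset.range k, (‖α‖ / p) ^ j ≤ K * Real.log N ^ ‖α‖ := by
  have hα' : ‖((‖α‖ : ℝ) : ℂ)‖ < 2 := by simpa using hα
  obtain ⟨C, K, -, hK, h⟩ := exists_smoothEulerProduct_eq hk hα'
  refine ⟨(‖C‖ + 1) * Real.exp K, by positivity, fun N hN hll => ?_⟩
  obtain ⟨δ, hδ, hδK⟩ := h N 0 hN hll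
  have hN' : (1 : ℝ) < N := by exact_mod_cast (by omega : 1 < N)
  have hL := Real.log_pos hN'
  have hL1 : 1 ≤ Real.log N := by
    by_contra! h
    exact absurd hll (not_le.2 (Real.log_neg hL h))
  have h1 : smoothEulerProduct k (‖α‖ : ℝ) N 0 =
      ((∏ p ∈ Nat.primesLE N, ∑ j ∈ Finset.range k, (‖α‖ / p) ^ j : ℝ) : ℂ) := by
    simp [smoothEulerProduct]
  have h2 : 0 ≤ ∏ p ∈ Nat.primesLE N, ∑ j ∈ Finset.range k, (‖α‖ / p) ^ j :=
    Finset.prod_nonneg fun p _ => Finset.sum_nonneg fun j _ => by positivity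
  have h3 : dickmanChar (‖α‖ : ℝ) (0 * Real.log N) = 1 := by
    rw [dickmanChar_eq_exp, dickmanExponent_eq_integral]; simp
  rw [← abs_of_nonneg h2, ← Real.norm_eq_abs, ← Complex.norm_real, ← h1, hδ, h3, mul_one, norm_mul,
    norm_mul, Complex.norm_cpow_eq_rpow_re_of_pos hL, Complex.ofReal_re]
  have h4 : ‖Complex.exp δ‖ ≤ Real.exp K := by
    rw [Complex.norm_exp]
    refine Real.exp_le_exp.2 ((Complex.re_le_norm _).trans (hδK.trans ?_))
    rw [abs_zero, zero_mul, add_zero]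
    exact mul_le_of_le_one_right hK.le (div_le_one_of_le₀ hL1 hL.le)
  calc _ ≤ (‖C‖ + 1) * Real.log N ^ ‖α‖ * Real.exp K := by gcongr; linarith
    _ = _ := by ring

theorem norm_smoothEulerProduct_le (k : ℕ) (α : ℂ) (N : ℕ) (t : ℝ) :
    ‖smoothEulerProduct k α N t‖ ≤ ∏ p ∈ Nat.primesLE N, ∑ j ∈ Finset.range k, (‖α‖ / p) ^ j := by
  rw [smoothEulerProduct, norm_prod]
  refine Finset.prod_le_prod (fun _ _ => norm_nonneg _) fun p _ => ?_
  refine norm_sum_le_of_le _ fun j _ => ?_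
  rw [norm_pow, norm_mul, Complex.norm_exp_I_mul_ofReal, mul_one, norm_div, Complex.norm_natCast]

/-! ### From the sum to Euler products. -/

/-- The Euler product identity for a sum over `k`-free integers without large prime factors. -/
theorem finsum_smoothKFree_eq_prod {k : ℕ} (hk : k ≠ 0) (N : ℕ) (G : ℕ → ℂ) (h1 : G 1 = 1)
    (hmul : ∀ m n, m ≠ 0 → n ≠ 0 → G (m * n) = G m * G n) :
    ∑ᶠ n ∈ smoothKFree k N, G n = ∏ p ∈ Nat.primesLE N, ∑ j ∈ Finset.range k, G p ^ j := by
  classical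
  -- The restriction of `G` to `k`-free integers is multiplicative only on coprime pairs: a prime
  -- power divides a coprime product only if it divides one factor. Its Euler factors are the
  -- truncated geometric sums.
  set f : ℕ → ℂ := fun n => if ∀ p : ℕ, p.Prime → ¬ p ^ k ∣ n then G n else 0
  have hf1 : f 1 = 1 := by
    have : ∀ p : ℕ, p.Prime → ¬ p ^ k ∣ 1 := fun p hp h =>
      hp.one_lt.ne' (Nat.dvd_one.1 ((dvd_pow_self p hk).trans h))
    simp only [f, if_pos this, h1]
  have hne : ∀ n : ℕ, (∀ p : ℕ, p.Prime → ¬ p ^ k ∣ n) → n ≠ 0 := fun n h h0 =>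
    h 2 Nat.prime_two (h0 ▸ dvd_zero _)
  have hfmul : ∀ {m n : ℕ}, Nat.Coprime m n → f (m * n) = f m * f n := by
    intro m n hmn
    have hiff : (∀ p : ℕ, p.Prime → ¬ p ^ k ∣ m * n) ↔
        (∀ p : ℕ, p.Prime → ¬ p ^ k ∣ m) ∧ ∀ p : ℕ, p.Prime → ¬ p ^ k ∣ n := by
      rw [← forall₂_and]
      refine forall₂_congr fun p hp => ?_
      rw [hmn.isPrimePow_dvd_mul (hp.isPrimePow.pow hk), not_or]
    simp only [f, hiff]
    by_cases hm : ∀ p : ℕ, p.Prime → ¬ p ^ k ∣ m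
    · by_cases hn : ∀ p : ℕ, p.Prime → ¬ p ^ k ∣ n
      · rw [if_pos ⟨hm, hn⟩, if_pos hm, if_pos hn, hmul m n (hne m hm) (hne n hn)]
      · rw [if_neg fun h => hn h.2, if_neg hn, mul_zero]
    · rw [if_neg fun h => hm h.1, if_neg hm, zero_mul]
  have hGpow : ∀ {p : ℕ}, p.Prime → ∀ j : ℕ, G (p ^ j) = G p ^ j := by
    intro p hp j
    induction j with
    | zero => simp [h1]
    | succ j ih => rw [pow_succ, hmul _ _ (pow_ne_zero _ hp.ne_zero) hp.ne_zero, ih, pow_succ]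
  have hfpow : ∀ {p : ℕ}, p.Prime → ∀ j : ℕ, f (p ^ j) = if j < k then G p ^ j else 0 := by
    intro p hp j
    have hiff : (∀ q : ℕ, q.Prime → ¬ q ^ k ∣ p ^ j) ↔ j < k := by
      constructor
      · intro h
        by_contra! hjk
        exact h p hp (pow_dvd_pow p hjk)
      · intro hjk q hq hd
        have hqp : q = p := (Nat.prime_dvd_prime_iff_eq hq hp).1
          (hq.dvd_of_dvd_pow ((dvd_pow_self q hk).trans hd))
        rw [hqp, Nat.pow_dvd_pow_iff_le_right hp.one_lt] at hd
        omega
    simp only [f, hiff, hGpow hp]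
  have hvan : ∀ {p : ℕ}, p.Prime → ∀ j, j ∉ Finset.range k → f (p ^ j) = 0 := by
    intro p hp j hj
    rw [hfpow hp, if_neg (by simpa using hj)]
  -- Prime factors of `M`-smooth numbers are strictly below `M`, hence `N + 1`.
  have hE := (EulerProduct.summable_and_hasSum_smoothNumbers_prod_primesBelow_tsum hf1 hfmul
    (fun {p} hp => summable_of_ne_finset_zero (s := Finset.range k)
      fun j hj => by rw [hvan hp j hj, norm_zero]) (N + 1)).2
  have hprod : ∏ p ∈ (N + 1).primesBelow, ∑' j : ℕ, f (p ^ j) =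
      ∏ p ∈ Nat.primesLE N, ∑ j ∈ Finset.range k, G p ^ j := by
    refine Finset.prod_congr rfl fun p hp => ?_
    have hpp := Nat.prime_of_mem_primesLE hp
    rw [tsum_eq_sum (s := Finset.range k) fun j hj => hvan hpp j hj]
    refine Finset.sum_congr rfl fun j hj => ?_
    rw [hfpow hpp, if_pos (Finset.mem_range.1 hj)]
  have hind : Set.indicator (Nat.smoothNumbers (N + 1)) f =
      Set.indicator (smoothKFree k N) G := by
    ext n
    by_cases hn : n ∈ smoothKFree k N
    · have hs : n ∈ Nat.smoothNumbers (N + 1) :=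
        Nat.mem_smoothNumbers'.2 fun p hp hd => Nat.lt_succ_of_le (hn.2.2 p hp hd)
      rw [Set.indicator_of_mem hn, Set.indicator_of_mem hs]
      exact if_pos hn.2.1
    · rw [Set.indicator_of_notMem hn]
      by_cases hs : n ∈ Nat.smoothNumbers (N + 1)
      · rw [Set.indicator_of_mem hs]
        refine if_neg fun h => hn ⟨hs.1, h, fun p hp hd => ?_⟩
        exact Nat.le_of_lt_succ (Nat.mem_smoothNumbers'.1 hs p hp hd)
      · rw [Set.indicator_of_notMem hs]
  have hS : HasSum (Set.indicator (smoothKFree k N) G)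
      (∏ p ∈ Nat.primesLE N, ∑ j ∈ Finset.range k, G p ^ j) := by
    rw [← hind, ← hprod]
    exact hasSum_subtype_iff_indicator.1 hE
  have hS' : HasSum (Set.indicator (smoothKFree k N) G)
      (∑ n ∈ (smoothKFree_finite k N).toFinset, Set.indicator (smoothKFree k N) G n) :=
    hasSum_sum_of_ne_finset_zero fun n hn =>
      Set.indicator_of_notMem (by simpa using hn) _
  rw [← hS'.unique hS, finsum_mem_eq_finite_toFinset_sum _ (smoothKFree_finite k N)]
  refine Finset.sum_congr rfl fun n hn => (Set.indicator_of_mem ?_ _).symm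
  simpa using hn

theorem finsum_smoothKFree_exp_eq_smoothEulerProduct {k : ℕ} (hk : k ≠ 0) (α : ℂ) (N : ℕ)
    (t : ℝ) :
    ∑ᶠ n ∈ smoothKFree k N, α ^ ArithmeticFunction.cardFactors n / (n : ℂ) *
      Complex.exp (Complex.I * (t * Real.log n : ℝ)) = smoothEulerProduct k α N t := by
  rw [finsum_smoothKFree_eq_prod hk N (fun n => α ^ ArithmeticFunction.cardFactors n / (n : ℂ) *
      Complex.exp (Complex.I * (t * Real.log n : ℝ))), smoothEulerProduct]
  · refine Finset.prod_congr rfl fun p hp => Finset.sum_congr rfl fun j _ => ?_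
    rw [ArithmeticFunction.cardFactors_apply_prime (Nat.prime_of_mem_primesLE hp), pow_one]
  · simp
  · intro m n hm hn
    have hm' : (m : ℝ) ≠ 0 := by exact_mod_cast hm
    have hn' : (n : ℝ) ≠ 0 := by exact_mod_cast hn
    rw [ArithmeticFunction.cardFactors_mul hm hn, pow_add, Nat.cast_mul, Nat.cast_mul,
      Real.log_mul hm' hn', mul_add, Complex.ofReal_add, mul_add, Complex.exp_add]
    have hm'' : (m : ℂ) ≠ 0 := by exact_mod_cast hm
    have hn'' : (n : ℂ) ≠ 0 := by exact_mod_cast hn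
    field_simp

theorem smoothSum_eq_sum (f : ℝ → ℂ) (k : ℕ) (α : ℂ) (N : ℕ) :
    smoothSum f k α N = ∑ n ∈ (smoothKFree_finite k N).toFinset,
      f (Real.log n / Real.log N) * (α ^ ArithmeticFunction.cardFactors n / (n : ℂ)) :=
  finsum_mem_eq_finite_toFinset_sum _ _

/-- Taking absolute values term by term gives the Euler product of `‖α‖` at `t = 0`. No Fourier
inversion is involved, so the bound serves the range `η ≤ 1`. -/
theorem norm_smoothSum_le {k : ℕ} (hk : k ≠ 0) (α : ℂ) (N : ℕ) {f : ℝ → ℂ} {M : ℝ}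
    (hf : ∀ x, ‖f x‖ ≤ M) :
    ‖smoothSum f k α N‖ ≤ M * ∏ p ∈ Nat.primesLE N, ∑ j ∈ Finset.range k, (‖α‖ / p) ^ j := by
  have hE := finsum_smoothKFree_exp_eq_smoothEulerProduct hk (‖α‖ : ℝ) N 0
  rw [finsum_mem_eq_finite_toFinset_sum _ (smoothKFree_finite k N)] at hE
  have hE' : ∑ n ∈ (smoothKFree_finite k N).toFinset,
      ‖α‖ ^ ArithmeticFunction.cardFactors n / (n : ℝ) =
      ∏ p ∈ Nat.primesLE N, ∑ j ∈ Finset.range k, (‖α‖ / p) ^ j := by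
    simp only [smoothEulerProduct, zero_mul, Complex.ofReal_zero, mul_zero, Complex.exp_zero,
      mul_one] at hE
    exact_mod_cast hE
  rw [smoothSum_eq_sum, ← hE', Finset.mul_sum]
  refine norm_sum_le_of_le _ fun n _ => ?_
  rw [norm_mul, norm_div, norm_pow, Complex.norm_natCast]
  gcongr
  exact hf _

/-- If `f` is the inverse Fourier transform of an integrable function, the sum `smoothSum` is an
integral of Euler products. -/
theorem smoothSum_eq_integral {k : ℕ} (hk : k ≠ 0) (α : ℂ) (N : ℕ) {f g : ℝ → ℂ}
    (hg : MeasureTheory.Integrable g)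
    (hfg : ∀ x, f x = ∫ t : ℝ, Complex.exp (Complex.I * (t * x : ℝ)) * g t) :
    smoothSum f k α N = ∫ t : ℝ, g t * smoothEulerProduct k α N (t / Real.log N) := by
  have hint : ∀ x : ℝ,
      MeasureTheory.Integrable fun t : ℝ => Complex.exp (Complex.I * (t * x : ℝ)) * g t := by
    intro x
    refine hg.bdd_mul (c := 1) (by fun_prop) (Filter.Eventually.of_forall fun t => ?_)
    rw [Complex.norm_exp_I_mul_ofReal]
  rw [smoothSum_eq_sum]
  simp only [hfg, ← MeasureTheory.integral_mul_const]
  rw [← MeasureTheory.integral_finsetSum _ fun n _ => (hint _).mul_const _]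
  congr 1; ext t
  rw [← finsum_smoothKFree_exp_eq_smoothEulerProduct hk,
    finsum_mem_eq_finite_toFinset_sum _ (smoothKFree_finite k N), Finset.mul_sum]
  refine Finset.sum_congr rfl fun n _ => ?_
  have : t / Real.log N * Real.log n = t * (Real.log n / Real.log N) := by ring
  rw [this]
  ring

/-! ### Distributional Fourier transforms: uniqueness and inversion. -/

theorem exists_schwartz_eq_one_nhds (x : ℝ) :
    ∃ ψ : 𝓢(ℝ, ℂ), ∀ᶠ y in nhds x, ψ y = 1 := by
  let b : ContDiffBump x := ⟨1, 2, one_pos, one_lt_two⟩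
  have hc : HasCompactSupport fun y => ((b y : ℝ) : ℂ) :=
    b.hasCompactSupport.comp_left Complex.ofReal_zero
  refine ⟨hc.toSchwartzMap (Complex.ofRealCLM.contDiff.comp b.contDiff), ?_⟩
  filter_upwards [b.eventuallyEq_one] with y hy
  exact (congrArg Complex.ofReal hy).trans Complex.ofReal_one

theorem IsFourierTransform.locallyIntegrable {f g : ℝ → ℂ} (h : IsFourierTransform f g) :
    MeasureTheory.LocallyIntegrable g := by
  intro x
  obtain ⟨ψ, hψ⟩ := exists_schwartz_eq_one_nhds x
  obtain ⟨U, hU, hUo, hxU⟩ := eventually_nhds_iff.1 hψ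
  refine ⟨U, hUo.mem_nhds hxU, ?_⟩
  refine ((h ψ).1.integrableOn (s := U)).congr_fun (fun y hy => ?_) hUo.measurableSet
  simp [hU y hy]

/-- Two Fourier transforms of the same function agree almost everywhere. -/
theorem IsFourierTransform.ae_eq {f g g' : ℝ → ℂ} (h : IsFourierTransform f g)
    (h' : IsFourierTransform f g') : g =ᵐ[MeasureTheory.volume] g' := by
  refine ae_eq_of_integral_contDiff_smul_eq h.locallyIntegrable h'.locallyIntegrable
    fun χ hχ hχc => ?_
  have hc : HasCompactSupport fun y => ((χ y : ℝ) : ℂ) := hχc.comp_left Complex.ofReal_zero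
  set ψ : 𝓢(ℝ, ℂ) := hc.toSchwartzMap (Complex.ofRealCLM.contDiff.comp hχ)
  have h1 : ∀ u : ℝ → ℂ, ∫ y, χ y • u y = ∫ y, u y * ψ y := fun u => by
    congr 1; ext y; exact Complex.real_smul.trans (mul_comm _ _)
  rw [h1, h1]
  exact (h ψ).2.2.trans (h' ψ).2.2.symm

/-- The Fourier inversion formula in the normalization of `fourierHat`. -/
theorem exists_schwartz_fourierHat_eq (χ : 𝓢(ℝ, ℂ)) :
    ∃ ψ : 𝓢(ℝ, ℂ), (∀ t : ℝ, ψ t = ∫ x : ℝ, Complex.exp (Complex.I * (t * x : ℝ)) * χ x) ∧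
      ∀ x, fourierHat ψ x = χ x := by
  have hπ : (2 * Real.pi) ≠ 0 := by positivity
  have hπ' : ((2 * Real.pi)⁻¹ : ℝ) ≠ 0 := inv_ne_zero hπ
  -- The dilation by `1 / 2π` passes between the kernels `e^{2πitx}` and `e^{itx}`.
  let e : ℝ ≃L[ℝ] ℝ := ContinuousLinearEquiv.unitsEquivAut ℝ (Units.mk0 (2 * Real.pi)⁻¹ hπ')
  have he : ∀ t, e t = t / (2 * Real.pi) := fun t => by
    simp [e, div_eq_mul_inv]
  have hval : ∀ t : ℝ, SchwartzMap.compCLMOfContinuousLinearEquiv ℂ e (𝓕⁻ χ) t =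
      (𝓕⁻ χ) (t / (2 * Real.pi)) := fun t => by
    rw [SchwartzMap.compCLMOfContinuousLinearEquiv_apply, Function.comp_apply, he]
  refine ⟨SchwartzMap.compCLMOfContinuousLinearEquiv ℂ e (𝓕⁻ χ), fun t => ?_, fun x => ?_⟩
  · rw [hval, SchwartzMap.fourierInv_coe, Real.fourierInv_eq']
    congr 1; ext x
    rw [smul_eq_mul]
    congr 2
    simp only [RCLike.inner_apply, conj_trivial]
    push_cast
    field_simp
  · have h1 : 𝓕 (𝓕⁻ χ) = χ := FourierTransform.fourier_fourierInv_eq χ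
    rw [fourierHat]
    simp only [hval]
    have h2 := MeasureTheory.Measure.integral_comp_div
      (fun s : ℝ => Complex.exp (-(Complex.I * (2 * Real.pi * s : ℝ) * x)) * (𝓕⁻ χ) s) (2 * Real.pi)
    have h3 : ∀ t : ℝ, 2 * Real.pi * (t / (2 * Real.pi)) = t := fun t => by field_simp
    simp only [h3] at h2
    rw [h2, abs_of_pos (by positivity), Complex.real_smul]
    have hπc : (2 * Real.pi : ℂ) ≠ 0 := by exact_mod_cast hπ
    push_cast
    rw [← mul_assoc, inv_mul_cancel₀ hπc, one_mul]
    conv_rhs => rw [← h1]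
    rw [SchwartzMap.fourier_coe, Real.fourier_real_eq_integral_exp_smul]
    congr 1; ext s
    rw [smul_eq_mul]
    congr 2
    push_cast
    ring

/-- A continuous function whose Fourier transform is integrable is recovered by the inversion
formula. -/
theorem IsFourierTransform.eq_integral {f g : ℝ → ℂ} (h : IsFourierTransform f g)
    (hf : Continuous f) (hg : MeasureTheory.Integrable g) (x : ℝ) :
    f x = ∫ t : ℝ, Complex.exp (Complex.I * (t * x : ℝ)) * g t := by
  set F : ℝ → ℂ := fun x => ∫ t : ℝ, Complex.exp (Complex.I * (t * x : ℝ)) * g t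
  have hF : Continuous F := by
    refine MeasureTheory.continuous_of_dominated (bound := fun t => ‖g t‖)
      (fun x => ?_) (fun x => ?_) hg.norm (Filter.Eventually.of_forall fun t => by fun_prop)
    · exact MeasureTheory.AEStronglyMeasurable.mul (by fun_prop) hg.aestronglyMeasurable
    · refine Filter.Eventually.of_forall fun t => ?_
      rw [norm_mul, Complex.norm_exp_I_mul_ofReal, one_mul]
  suffices hae : f =ᵐ[MeasureTheory.volume] F from
    congrFun ((Continuous.ae_eq_iff_eq MeasureTheory.volume hf hF).1 hae) x
  refine ae_eq_of_integral_contDiff_smul_eq hf.locallyIntegrable hF.locallyIntegrable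
    fun χ hχ hχc => ?_
  have hc : HasCompactSupport fun y => ((χ y : ℝ) : ℂ) := hχc.comp_left Complex.ofReal_zero
  set X : 𝓢(ℝ, ℂ) := hc.toSchwartzMap (Complex.ofRealCLM.contDiff.comp hχ)
  have hX : ∀ y, X y = χ y := fun _ => rfl
  -- The test function is written as `fourierHat ψ`; the defining identity for `ψ` and Fubini then
  -- turn the pairing with `f` into the pairing with `F`.
  obtain ⟨ψ, hψ, hψX⟩ := exists_schwartz_fourierHat_eq X
  have h1 := (h ψ).2.2
  simp only [hψX, hψ, ← MeasureTheory.integral_const_mul] at h1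
  have hprod : MeasureTheory.Integrable (Function.uncurry fun t y : ℝ =>
      g t * (Complex.exp (Complex.I * (t * y : ℝ)) * X y))
      (MeasureTheory.volume.prod MeasureTheory.volume) := by
    have h2 : MeasureTheory.Integrable (fun z : ℝ × ℝ => g z.1 * X z.2)
        (MeasureTheory.volume.prod MeasureTheory.volume) := hg.mul_prod X.integrable
    refine (h2.bdd_mul (c := 1) (f := fun z : ℝ × ℝ =>
      Complex.exp (Complex.I * (z.1 * z.2 : ℝ)))
      (by fun_prop) (Filter.Eventually.of_forall fun z => ?_)).congr
      (Filter.Eventually.of_forall fun z => ?_)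
    · rw [Complex.norm_exp_I_mul_ofReal]
    · simp only [Function.uncurry]; ring
  rw [MeasureTheory.integral_integral_swap hprod] at h1
  calc ∫ y, χ y • f y = ∫ y, f y * X y := by
        congr 1; ext y; rw [hX, Complex.real_smul, mul_comm]
    _ = _ := h1.symm
    _ = _ := by
      congr 1; ext y
      rw [Complex.real_smul, ← hX, ← MeasureTheory.integral_const_mul]
      congr 1; ext t; ring

/-! ### Integrals of powers of `1 + |t|`. -/

theorem one_div_one_add_rpow_le {η : ℝ} (hη : 0 < η) (t : ℝ) :
    1 / (1 + |t| ^ η) ≤ 2 ^ η * (1 + |t|) ^ (-η) := by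
  have h0 : 0 ≤ |t| := abs_nonneg t
  have h1 : (1 + |t|) ^ η ≤ 2 ^ η * (1 + |t| ^ η) := by
    have h2 : 0 ≤ |t| ^ η := Real.rpow_nonneg h0 η
    have h3 : (0 : ℝ) < 2 ^ η := by positivity
    rcases le_total |t| 1 with h | h
    · calc (1 + |t|) ^ η ≤ 2 ^ η := Real.rpow_le_rpow (by positivity) (by linarith) hη.le
        _ ≤ _ := by nlinarith
    · calc (1 + |t|) ^ η ≤ (2 * |t|) ^ η := Real.rpow_le_rpow (by positivity) (by linarith) hη.le
        _ = 2 ^ η * |t| ^ η := Real.mul_rpow (by norm_num) h0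
        _ ≤ _ := by nlinarith
  rw [Real.rpow_neg (by positivity), ← div_eq_mul_inv, div_le_div_iff₀ (by positivity)
    (by positivity), one_mul]
  exact h1

theorem setOf_abs_le_eq_Icc (R : ℝ) : {t : ℝ | |t| ≤ R} = Set.Icc (-R) R := by
  ext t; simp [abs_le]

theorem continuous_one_add_abs_rpow (s : ℝ) : Continuous fun t : ℝ => (1 + |t|) ^ s :=
  Continuous.rpow_const (by fun_prop) fun t => Or.inl (by positivity)

theorem integrableOn_abs_le {E : Type*} [NormedAddCommGroup E] {F : ℝ → E} (hF : Continuous F)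
    (R : ℝ) : MeasureTheory.IntegrableOn F {t : ℝ | |t| ≤ R} := by
  rw [setOf_abs_le_eq_Icc]; exact hF.integrableOn_Icc

theorem integrable_one_add_abs_rpow {r : ℝ} (hr : 1 < r) :
    MeasureTheory.Integrable fun t : ℝ => (1 + |t|) ^ (-r) :=
  integrable_one_add_norm (E := ℝ) (by simpa using hr)

/-- Truncated integrals of powers of `1 + |t|`. -/
theorem exists_setIntegral_one_add_abs_rpow_le (s : ℝ) {δ : ℝ} (hδ : 0 < δ) :
    ∃ K : ℝ, 0 < K ∧ ∀ R : ℝ, 1 ≤ R →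
      ∫ t in {t : ℝ | |t| ≤ R}, (1 + |t|) ^ (-s) ≤ K * max 1 (R ^ (1 - s + δ)) := by
  have hpos : ∀ (c t : ℝ), 0 ≤ (1 + |t|) ^ c := fun c t => by positivity
  rcases lt_or_ge 1 s with hs | hs
  · have h0 : 0 ≤ ∫ t : ℝ, (1 + |t|) ^ (-s) := MeasureTheory.integral_nonneg fun t => hpos _ t
    refine ⟨(∫ t : ℝ, (1 + |t|) ^ (-s)) + 1, by positivity, fun R hR => ?_⟩
    have h1 : ∫ t in {t : ℝ | |t| ≤ R}, (1 + |t|) ^ (-s) ≤ ∫ t : ℝ, (1 + |t|) ^ (-s) :=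
      MeasureTheory.setIntegral_le_integral (integrable_one_add_abs_rpow hs)
        (Filter.Eventually.of_forall fun t => hpos _ t)
    have h2 : 1 ≤ max 1 (R ^ (1 - s + δ)) := le_max_left _ _
    nlinarith
  -- An integrable power is split off and the rest is at most `(2R)^(1 - s + δ)`. The slack `δ`
  -- avoids a logarithm at `s = 1`.
  · set J := ∫ t : ℝ, (1 + |t|) ^ (-(1 + δ))
    have h0 : 0 ≤ J := MeasureTheory.integral_nonneg fun t => hpos _ t
    refine ⟨J * 2 ^ (1 - s + δ) + 1, by positivity, fun R hR => ?_⟩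
    have hJi := integrable_one_add_abs_rpow (r := 1 + δ) (by linarith)
    have h1 : ∫ t in {t : ℝ | |t| ≤ R}, (1 + |t|) ^ (-s) ≤
        ∫ t in {t : ℝ | |t| ≤ R}, (1 + |t|) ^ (-(1 + δ)) * (2 * R) ^ (1 - s + δ) := by
      refine MeasureTheory.setIntegral_mono_on
        (integrableOn_abs_le (continuous_one_add_abs_rpow _) R)
        (hJi.mul_const _).integrableOn ?_ fun t ht => ?_
      · rw [setOf_abs_le_eq_Icc]; exact measurableSet_Icc
      · have ht' : |t| ≤ R := ht
        have h2 : (1 + |t|) ^ (-s) = (1 + |t|) ^ (-(1 + δ)) * (1 + |t|) ^ (1 - s + δ) := by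
          rw [← Real.rpow_add (by positivity)]; ring_nf
        rw [h2]
        exact mul_le_mul_of_nonneg_left
          (Real.rpow_le_rpow (by positivity) (by linarith) (by linarith)) (hpos _ t)
    have h3 : ∫ t in {t : ℝ | |t| ≤ R}, (1 + |t|) ^ (-(1 + δ)) ≤ J :=
      MeasureTheory.setIntegral_le_integral hJi (Filter.Eventually.of_forall fun t => hpos _ t)
    rw [MeasureTheory.integral_mul_const, Real.mul_rpow (by norm_num) (by linarith)] at h1
    have h4 : R ^ (1 - s + δ) ≤ max 1 (R ^ (1 - s + δ)) := le_max_right _ _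
    have h5 : 0 ≤ R ^ (1 - s + δ) := by positivity
    calc _ ≤ _ := h1
      _ ≤ J * (2 ^ (1 - s + δ) * R ^ (1 - s + δ)) := by gcongr
      _ = J * 2 ^ (1 - s + δ) * R ^ (1 - s + δ) := by ring
      _ ≤ J * 2 ^ (1 - s + δ) * max 1 (R ^ (1 - s + δ)) := by gcongr
      _ ≤ _ := by gcongr; linarith

theorem setIntegral_one_add_abs_rpow_tail_le {η : ℝ} (hη : 1 < η) {R : ℝ} (hR : 0 < R) :
    ∫ t in {t : ℝ | |t| ≤ R}ᶜ, (1 + |t|) ^ (-η) ≤ 2 / (η - 1) * R ^ (1 - η) := by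
  set F : ℝ → ℝ := Set.indicator (Set.Ioi R) fun x => (1 + x) ^ (-η)
  have hm : MeasurableSet {t : ℝ | |t| ≤ R}ᶜ := by
    rw [setOf_abs_le_eq_Icc]; exact measurableSet_Icc.compl
  have h1 : ∫ t in {t : ℝ | |t| ≤ R}ᶜ, (1 + |t|) ^ (-η) = ∫ t : ℝ, F |t| := by
    rw [← MeasureTheory.integral_indicator hm]
    congr 1; ext t
    by_cases h : |t| ≤ R
    · simp [F, Set.indicator, h]
    · simp [F, Set.indicator, h, not_le.1 h]
  have h2 : ∫ t in Set.Ioi (0 : ℝ), F t = ∫ t in Set.Ioi R, (1 + t) ^ (-η) := by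
    rw [MeasureTheory.setIntegral_indicator measurableSet_Ioi, Set.Ioi_inter_Ioi,
      max_eq_right hR.le]
  have hmono : ∀ t ∈ Set.Ioi R, (1 + t) ^ (-η) ≤ t ^ (-η) := fun t ht =>
    Real.rpow_le_rpow_of_nonpos (hR.trans ht) (by linarith) (by linarith)
  have hi := integrableOn_Ioi_rpow_of_lt (a := -η) (by linarith) hR
  have h3 : ∫ t in Set.Ioi R, (1 + t) ^ (-η) ≤ ∫ t in Set.Ioi R, t ^ (-η) := by
    refine MeasureTheory.integral_mono_of_nonneg ?_ hi ?_
    · filter_upwards [MeasureTheory.ae_restrict_mem measurableSet_Ioi] with t ht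
      exact Real.rpow_nonneg (by linarith [hR.trans ht]) _
    · filter_upwards [MeasureTheory.ae_restrict_mem measurableSet_Ioi] with t ht using hmono t ht
  rw [integral_Ioi_rpow_of_lt (by linarith) hR] at h3
  rw [h1, integral_comp_abs, h2]
  have h4 : -R ^ (-η + 1) / (-η + 1) = R ^ (1 - η) / (η - 1) := by
    rw [show -η + 1 = -(η - 1) by ring, neg_div_neg_eq, show -(η - 1) = 1 - η by ring]
  rw [h4] at h3
  calc _ ≤ 2 * (R ^ (1 - η) / (η - 1)) := by gcongr
    _ = _ := by ring

/-! ### The error estimates. -/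

/-- The quantity `ℓ = log log N ≥ 1` controls the other parameters. -/
theorem one_le_cutoff_of_one_le_log_log {N : ℕ} (h : 1 ≤ Real.log (Real.log N)) :
    2 ≤ N ∧ 1 ≤ Real.log N ∧ 1 ≤ cutoff N ∧
      Real.log N = cutoff N * Real.log (Real.log N) := by
  have hL0 : 0 ≤ Real.log N := Real.log_natCast_nonneg N
  have hL : 1 ≤ Real.log N := by
    by_contra! hlt
    linarith [Real.log_nonpos hL0 hlt.le]
  have hN : 2 ≤ N := by
    by_contra! hlt
    interval_cases N <;> simp at hL <;> linarith
  have hle : Real.log (Real.log N) ≤ Real.log N :=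
    (Real.log_le_sub_one_of_pos (by linarith)).trans (by linarith)
  refine ⟨hN, hL, ?_, ?_⟩
  · rw [cutoff, le_div_iff₀ (by linarith), one_mul]; exact hle
  · rw [cutoff]; field_simp

/-- The difference of the normalized sum and the truncated integral. -/
noncomputable def smoothSumError (f g : ℝ → ℂ) (k : ℕ) (α C : ℂ) (N : ℕ) : ℂ :=
  smoothSum f k α N / (C * (Real.log N : ℂ) ^ α) -
    ∫ t in {t : ℝ | |t| ≤ cutoff N}, dickmanChar α t * g t

/-- The common bound for the errors. -/
noncomputable def errorBound (a η : ℝ) (N : ℕ) : ℝ :=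
  1 / cutoff N + cutoff N ^ (a + 1 - η) * Real.log (Real.log N) ^ a

theorem norm_exp_sub_one_le_mul_exp (z : ℂ) : ‖Complex.exp z - 1‖ ≤ ‖z‖ * Real.exp ‖z‖ := by
  simpa using Complex.norm_exp_sub_sum_le_norm_mul_exp z 1

theorem norm_log_cpow {N : ℕ} (h : 1 ≤ Real.log N) (α : ℂ) :
    ‖(Real.log N : ℂ) ^ α‖ = Real.log N ^ α.re :=
  Complex.norm_cpow_eq_rpow_re_of_pos (by linarith) α

theorem cutoff_rpow_mul_log_log_rpow_le_errorBound {a η : ℝ} {N : ℕ}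
    (h : 1 ≤ Real.log (Real.log N)) :
    cutoff N ^ (a + 1 - η) * Real.log (Real.log N) ^ a ≤ errorBound a η N := by
  obtain ⟨-, -, hR, -⟩ := one_le_cutoff_of_one_le_log_log h
  rw [errorBound]
  exact le_add_of_nonneg_left (by positivity)

theorem cutoff_rpow_le_mul_log_log_rpow {a : ℝ} (ha : 0 ≤ a) (c : ℝ) {N : ℕ}
    (h : 1 ≤ Real.log (Real.log N)) :
    cutoff N ^ c ≤ cutoff N ^ c * Real.log (Real.log N) ^ a := by
  obtain ⟨-, -, hR, -⟩ := one_le_cutoff_of_one_le_log_log h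
  exact le_mul_of_one_le_right (by positivity) (Real.one_le_rpow h ha)

/-- The error when the Fourier transform is integrable. -/
theorem exists_norm_smoothSumError_le_of_one_lt {k : ℕ} (hk : 2 ≤ k) {α C : ℂ} (hα0 : α ≠ 0)
    (hC : C ≠ 0) {K₁ K₂ : ℝ} (hK₁ : 0 < K₁) (hK₂ : 0 < K₂)
    (h₁ : ∀ (N : ℕ) (t : ℝ), 2 ≤ N → 0 ≤ Real.log (Real.log N) →
      ∃ δ : ℂ, smoothEulerProduct k α N t =
          C * (Real.log N : ℂ) ^ α * dickmanChar α (t * Real.log N) * Complex.exp δ ∧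
        ‖δ‖ ≤ K₁ * (1 / Real.log N + |t| * (1 + Real.log (Real.log N))))
    (h₂ : ∀ N : ℕ, 2 ≤ N → 0 ≤ Real.log (Real.log N) →
      ∏ p ∈ Nat.primesLE N, ∑ j ∈ Finset.range k, (‖α‖ / p) ^ j ≤ K₂ * Real.log N ^ ‖α‖)
    {η : ℝ} (hη : 1 < η) {f g : ℝ → ℂ} (hg : MeasureTheory.AEStronglyMeasurable g)
    {A : ℝ} (hA : 0 < A) (hgA : ∀ t, ‖g t‖ ≤ A * (1 + |t|) ^ (-η))
    (hfg : ∀ x, f x = ∫ t : ℝ, Complex.exp (Complex.I * (t * x : ℝ)) * g t) :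
    ∃ K : ℝ, ∀ N : ℕ, 1 ≤ Real.log (Real.log N) →
      ‖smoothSumError f g k α C N‖ ≤ K * errorBound (‖α‖ - α.re) η N := by
  -- The power collects the decay of `dickmanChar` and of `g` and one factor `1 + |t|` from `e^δ -
  -- 1`. The slack `‖α‖`, positive since `α ≠ 0`, replaces `-α.re` by `‖α‖ - α.re` in the exponent
  -- of `R`, which is exactly what `errorBound` allows.
  obtain ⟨K₃, hK₃, h₃⟩ := exists_setIntegral_one_add_abs_rpow_le (α.re + η - 1) (norm_pos_iff.2 hα0)
  set B := A * Real.exp (5 * ‖α‖) * (2 * K₁ * Real.exp (4 * K₁))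
  have hB : 0 < B := by positivity
  have hη1 : 0 < η - 1 := by linarith
  have hCn : 0 < ‖C‖ := norm_pos_iff.2 hC
  set D := A * K₂ / ‖C‖ * (2 / (η - 1))
  have hD : 0 < D := by positivity
  refine ⟨B * K₃ + D, fun N hℓ => ?_⟩
  obtain ⟨hN, hL, hR, hLR⟩ := one_le_cutoff_of_one_le_log_log hℓ
  set L := Real.log N
  set ℓ := Real.log L
  set R := cutoff N
  have hL0 : 0 < L := by linarith
  have hR0 : 0 < R := by linarith
  have hLα : ((L : ℝ) : ℂ) ^ α ≠ 0 := by
    rw [← norm_pos_iff, norm_log_cpow hL]; positivity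
  have hgi : MeasureTheory.Integrable g :=
    ((integrable_one_add_abs_rpow hη).const_mul A).mono' hg (Filter.Eventually.of_forall hgA)
  have hm : MeasurableSet {t : ℝ | |t| ≤ R} := by
    rw [setOf_abs_le_eq_Icc]; exact measurableSet_Icc
  set P : ℝ → ℂ := fun t => smoothEulerProduct k α N (t / L)
  have hPc : Continuous P := by
    simp only [P, smoothEulerProduct]; fun_prop
  have hPb : ∀ t, ‖P t‖ ≤ K₂ * L ^ ‖α‖ := fun t =>
    (norm_smoothEulerProduct_le k α N _).trans (h₂ N hN (by linarith))
  set Q : ℝ → ℂ := fun t => g t * P t / (C * (L : ℂ) ^ α)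
  have hPi : MeasureTheory.Integrable fun t => g t * P t :=
    hgi.mul_bdd hPc.aestronglyMeasurable (Filter.Eventually.of_forall hPb)
  have hQi : MeasureTheory.Integrable Q := hPi.div_const _
  have hS : smoothSum f k α N / (C * (L : ℂ) ^ α) =
      (∫ t in {t : ℝ | |t| ≤ R}, Q t) + ∫ t in {t : ℝ | |t| ≤ R}ᶜ, Q t := by
    rw [MeasureTheory.integral_add_compl hm hQi, MeasureTheory.integral_div,
      smoothSum_eq_integral (by omega) α N hgi hfg]
  have hφi : MeasureTheory.IntegrableOn (fun t => dickmanChar α t * g t) {t : ℝ | |t| ≤ R} := by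
    rw [setOf_abs_le_eq_Icc]
    exact hgi.integrableOn.continuousOn_mul (continuous_dickmanChar α).continuousOn isCompact_Icc
  have hsplit : smoothSumError f g k α C N =
      (∫ t in {t : ℝ | |t| ≤ R}, (Q t - dickmanChar α t * g t)) +
        ∫ t in {t : ℝ | |t| ≤ R}ᶜ, Q t := by
    rw [MeasureTheory.integral_sub hQi.integrableOn hφi, smoothSumError, hS]
    ring
  have ha : 0 ≤ ‖α‖ - α.re := sub_nonneg.2 (Complex.re_le_norm α)
  have hRL : R ≤ L := hLR ▸ le_mul_of_one_le_right hR0.le hℓ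
  have hℓL : ℓ / L = 1 / R := by rw [hLR]; field_simp
  have hin : ∀ t ∈ {t : ℝ | |t| ≤ R}, ‖Q t - dickmanChar α t * g t‖ ≤
      B / R * (1 + |t|) ^ (-(α.re + η - 1)) := by
    intro t ht
    have ht' : |t| ≤ R := ht
    have h0 : 0 < 1 + |t| := by positivity
    obtain ⟨δ, hδ, hδK⟩ := h₁ N (t / L) hN (by linarith)
    rw [div_mul_cancel₀ t hL0.ne'] at hδ
    -- Since `ℓ ≥ 1`, `(1 + ℓ) / L ≤ 2 ℓ / L = 2 / R`.
    have hδ1 : ‖δ‖ ≤ 2 * K₁ * ((1 + |t|) / R) := by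
      refine hδK.trans ?_
      have e1 : 1 / L ≤ 1 / R := one_div_le_one_div_of_le hR0 hRL
      have e2 : |t / L| * (1 + ℓ) ≤ 2 * |t| * (1 / R) := by
        rw [← hℓL, abs_div, abs_of_pos hL0]
        calc |t| / L * (1 + ℓ) ≤ |t| / L * (2 * ℓ) := by gcongr; linarith
          _ = _ := by ring
      calc K₁ * (1 / L + |t / L| * (1 + ℓ)) ≤ K₁ * (2 * (1 / R) + 2 * |t| * (1 / R)) := by
            gcongr; linarith [one_div_pos.2 hR0]
        _ = _ := by ring
    have hδ2 : ‖δ‖ ≤ 4 * K₁ := by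
      refine hδ1.trans ?_
      have : (1 + |t|) / R ≤ 2 := by rw [div_le_iff₀ hR0]; linarith
      nlinarith
    have hexp : ‖Complex.exp δ - 1‖ ≤ 2 * K₁ * ((1 + |t|) / R) * Real.exp (4 * K₁) :=
      (norm_exp_sub_one_le_mul_exp δ).trans (by gcongr)
    have hQ : Q t - dickmanChar α t * g t =
        g t * dickmanChar α t * (Complex.exp δ - 1) := by
      have hP : P t = C * (L : ℂ) ^ α * dickmanChar α t * Complex.exp δ := hδ
      simp only [Q]
      rw [hP]
      field_simp
    have hpow : (1 + |t|) ^ (-(α.re + η - 1)) =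
        (1 + |t|) ^ (-η) * (1 + |t|) ^ (-α.re) * (1 + |t|) := by
      rw [← Real.rpow_add h0, ← Real.rpow_add_one h0.ne']; ring_nf
    rw [hQ, norm_mul, norm_mul, hpow]
    calc ‖g t‖ * ‖dickmanChar α t‖ * ‖Complex.exp δ - 1‖
        ≤ (A * (1 + |t|) ^ (-η)) * (Real.exp (5 * ‖α‖) * (1 + |t|) ^ (-α.re)) *
          (2 * K₁ * ((1 + |t|) / R) * Real.exp (4 * K₁)) := by
          gcongr
          · exact hgA t
          · exact norm_dickmanChar_le α t
      _ = _ := by simp only [B]; ring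
  have hLa : L ^ ‖α‖ / L ^ α.re = R ^ (‖α‖ - α.re) * ℓ ^ (‖α‖ - α.re) := by
    rw [← Real.rpow_sub hL0, hLR, Real.mul_rpow hR0.le (by linarith)]
  -- Beyond the cutoff only the majorant of the Euler product is used; dividing by `‖L^α‖ = L^α.re`
  -- leaves `L^(‖α‖ - α.re)`.
  have hout : ∀ t, ‖Q t‖ ≤ A * K₂ / ‖C‖ * (R ^ (‖α‖ - α.re) * ℓ ^ (‖α‖ - α.re)) *
      (1 + |t|) ^ (-η) := by
    intro t
    rw [← hLa, norm_div, norm_mul, norm_mul, norm_log_cpow hL]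
    calc ‖g t‖ * ‖P t‖ / (‖C‖ * L ^ α.re)
        ≤ (A * (1 + |t|) ^ (-η)) * (K₂ * L ^ ‖α‖) / (‖C‖ * L ^ α.re) := by
          gcongr
          · exact hgA t
          · exact hPb t
      _ = _ := by field_simp
  have hE₁ : ‖∫ t in {t : ℝ | |t| ≤ R}, (Q t - dickmanChar α t * g t)‖ ≤
      B * K₃ * errorBound (‖α‖ - α.re) η N := by
    refine (MeasureTheory.norm_integral_le_of_norm_le
      (integrableOn_abs_le ((continuous_one_add_abs_rpow _).const_mul (B / R)) R)
      (by filter_upwards [MeasureTheory.ae_restrict_mem hm] with t ht using hin t ht)).trans ?_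
    rw [MeasureTheory.integral_const_mul]
    calc _ ≤ B / R * (K₃ * max 1 (R ^ (1 - (α.re + η - 1) + ‖α‖))) := by gcongr; exact h₃ R hR
      _ ≤ B / R * (K₃ * (1 + R ^ (1 - (α.re + η - 1) + ‖α‖))) := by
          gcongr
          exact max_le_add_of_nonneg zero_le_one (by positivity)
      _ = B * K₃ * (1 / R + R ^ (‖α‖ - α.re + 1 - η)) := by
          have : R ^ (1 - (α.re + η - 1) + ‖α‖) = R ^ (‖α‖ - α.re + 1 - η) * R := by
            rw [← Real.rpow_add_one hR0.ne']; ring_nf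
          rw [this]; field_simp
      _ ≤ _ := by
          rw [errorBound]
          gcongr
          exact cutoff_rpow_le_mul_log_log_rpow ha _ hℓ
  have hE₂ : ‖∫ t in {t : ℝ | |t| ≤ R}ᶜ, Q t‖ ≤ D * errorBound (‖α‖ - α.re) η N := by
    refine (MeasureTheory.norm_integral_le_of_norm_le
      ((integrable_one_add_abs_rpow hη).const_mul _).integrableOn
      (Filter.Eventually.of_forall hout)).trans ?_
    rw [MeasureTheory.integral_const_mul]
    calc _ ≤ A * K₂ / ‖C‖ * (R ^ (‖α‖ - α.re) * ℓ ^ (‖α‖ - α.re)) *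
          (2 / (η - 1) * R ^ (1 - η)) := by
          gcongr; exact setIntegral_one_add_abs_rpow_tail_le hη hR0
      _ = D * (R ^ (‖α‖ - α.re + 1 - η) * ℓ ^ (‖α‖ - α.re)) := by
          rw [show ‖α‖ - α.re + 1 - η = (‖α‖ - α.re) + (1 - η) by ring, Real.rpow_add hR0]
          simp only [D]; ring
      _ ≤ _ := by gcongr; exact cutoff_rpow_mul_log_log_rpow_le_errorBound hℓ
  rw [hsplit, add_mul]
  exact (norm_add_le _ _).trans (add_le_add hE₁ hE₂)

/-- The error when the Fourier transform need not be integrable. -/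
theorem exists_norm_smoothSumError_le_of_le_one {k : ℕ} (hk : 2 ≤ k) {α C : ℂ} (hα0 : α ≠ 0)
    (hC : C ≠ 0) {K₂ : ℝ} (hK₂ : 0 < K₂)
    (h₂ : ∀ N : ℕ, 2 ≤ N → 0 ≤ Real.log (Real.log N) →
      ∏ p ∈ Nat.primesLE N, ∑ j ∈ Finset.range k, (‖α‖ / p) ^ j ≤ K₂ * Real.log N ^ ‖α‖)
    {η : ℝ} (hη : η ≤ 1) {f g : ℝ → ℂ} {M : ℝ} (hf : ∀ x, ‖f x‖ ≤ M)
    {A : ℝ} (hA : 0 < A) (hgA : ∀ t, ‖g t‖ ≤ A * (1 + |t|) ^ (-η)) :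
    ∃ K : ℝ, ∀ N : ℕ, 1 ≤ Real.log (Real.log N) →
      ‖smoothSumError f g k α C N‖ ≤ K * errorBound (‖α‖ - α.re) η N := by
  obtain ⟨K₃, hK₃, h₃⟩ := exists_setIntegral_one_add_abs_rpow_le (α.re + η) (norm_pos_iff.2 hα0)
  have hM : 0 ≤ M := (norm_nonneg _).trans (hf 0)
  have hCn : 0 < ‖C‖ := norm_pos_iff.2 hC
  have ha : 0 ≤ ‖α‖ - α.re := sub_nonneg.2 (Complex.re_le_norm α)
  refine ⟨M * K₂ / ‖C‖ + A * Real.exp (5 * ‖α‖) * K₃, fun N hℓ => ?_⟩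
  obtain ⟨hN, hL, hR, hLR⟩ := one_le_cutoff_of_one_le_log_log hℓ
  set L := Real.log N
  set ℓ := Real.log L
  set R := cutoff N
  have hL0 : 0 < L := by linarith
  have hR0 : 0 < R := by linarith
  have hm : MeasurableSet {t : ℝ | |t| ≤ R} := by
    rw [setOf_abs_le_eq_Icc]; exact measurableSet_Icc
  have hLa : L ^ ‖α‖ / L ^ α.re = R ^ (‖α‖ - α.re) * ℓ ^ (‖α‖ - α.re) := by
    rw [← Real.rpow_sub hL0, hLR, Real.mul_rpow hR0.le (by linarith)]
  -- The trivial bound is `L^a = R^a ℓ^a` with `a = ‖α‖ - α.re`. It suffices because `R^(1 - η) ≥ 1`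
  -- when `η ≤ 1`.
  have hE₁ : ‖smoothSum f k α N / (C * (L : ℂ) ^ α)‖ ≤
      M * K₂ / ‖C‖ * errorBound (‖α‖ - α.re) η N := by
    rw [norm_div, norm_mul, norm_log_cpow hL]
    calc _ ≤ M * (K₂ * L ^ ‖α‖) / (‖C‖ * L ^ α.re) := by
          gcongr
          refine (norm_smoothSum_le (by omega) α N hf).trans ?_
          gcongr
          exact h₂ N hN (by linarith)
      _ = M * K₂ / ‖C‖ * (L ^ ‖α‖ / L ^ α.re) := by field_simp
      _ = M * K₂ / ‖C‖ * (R ^ (‖α‖ - α.re) * ℓ ^ (‖α‖ - α.re)) := by rw [hLa]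
      _ ≤ M * K₂ / ‖C‖ * (R ^ (‖α‖ - α.re + 1 - η) * ℓ ^ (‖α‖ - α.re)) := by
          have := Real.rpow_le_rpow_of_exponent_le hR
            (by linarith : ‖α‖ - α.re ≤ ‖α‖ - α.re + 1 - η)
          gcongr
      _ ≤ _ := by gcongr; exact cutoff_rpow_mul_log_log_rpow_le_errorBound hℓ
  have hE₂ : ‖∫ t in {t : ℝ | |t| ≤ R}, dickmanChar α t * g t‖ ≤
      A * Real.exp (5 * ‖α‖) * K₃ * errorBound (‖α‖ - α.re) η N := by
    have hb : ∀ t, ‖dickmanChar α t * g t‖ ≤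
        A * Real.exp (5 * ‖α‖) * (1 + |t|) ^ (-(α.re + η)) := by
      intro t
      rw [norm_mul, neg_add, Real.rpow_add (by positivity)]
      calc _ ≤ (Real.exp (5 * ‖α‖) * (1 + |t|) ^ (-α.re)) * (A * (1 + |t|) ^ (-η)) := by
            gcongr
            · exact norm_dickmanChar_le α t
            · exact hgA t
        _ = _ := by ring
    refine (MeasureTheory.norm_integral_le_of_norm_le
      (integrableOn_abs_le ((continuous_one_add_abs_rpow _).const_mul _) R)
      (Filter.Eventually.of_forall hb)).trans ?_
    rw [MeasureTheory.integral_const_mul]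
    have hmax : max 1 (R ^ (1 - (α.re + η) + ‖α‖)) = R ^ (‖α‖ - α.re + 1 - η) := by
      rw [show 1 - (α.re + η) + ‖α‖ = ‖α‖ - α.re + 1 - η by ring]
      exact max_eq_right (Real.one_le_rpow hR (by linarith))
    calc _ ≤ A * Real.exp (5 * ‖α‖) * (K₃ * max 1 (R ^ (1 - (α.re + η) + ‖α‖))) := by
          gcongr; exact h₃ R hR
      _ = A * Real.exp (5 * ‖α‖) * K₃ * R ^ (‖α‖ - α.re + 1 - η) := by rw [hmax]; ring
      _ ≤ _ := by
          gcongr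
          exact (cutoff_rpow_le_mul_log_log_rpow ha _ hℓ).trans
            (cutoff_rpow_mul_log_log_rpow_le_errorBound hℓ)
  rw [smoothSumError, add_mul]
  exact (norm_sub_le _ _).trans (add_le_add hE₁ hE₂)

/-! ### Comparison with the stated rates, and the theorem. -/

theorem cutoff_rpow_mul_eq {a η : ℝ} {N : ℕ} (h : 1 ≤ Real.log (Real.log N)) :
    cutoff N ^ (a + 1 - η) * Real.log (Real.log N) ^ a =
      Real.log (Real.log N) ^ (η - 1) / Real.log N ^ (η - (a + 1)) := by
  obtain ⟨-, hL, -, -⟩ := one_le_cutoff_of_one_le_log_log h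
  have hL0 : 0 < Real.log N := by linarith
  have hℓ0 : 0 < Real.log (Real.log N) := by linarith
  rw [cutoff, Real.div_rpow hL0.le hℓ0.le, div_mul_eq_mul_div, mul_div_assoc,
    ← Real.rpow_sub hℓ0, show η - (a + 1) = -(a + 1 - η) by ring, Real.rpow_neg hL0.le,
    div_inv_eq_mul, mul_comm, show a - (a + 1 - η) = η - 1 by ring]

theorem tendsto_log_natCast : Filter.Tendsto (fun N : ℕ => Real.log N) Filter.atTop Filter.atTop :=
  Real.tendsto_log_atTop.comp tendsto_natCast_atTop_atTop

theorem eventually_one_le_log_log : ∀ᶠ N : ℕ in Filter.atTop, 1 ≤ Real.log (Real.log N) :=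
  (Real.tendsto_log_atTop.comp tendsto_log_natCast).eventually_ge_atTop 1

theorem tendsto_log_log_rpow_div_log_rpow (r : ℝ) {s : ℝ} (hs : 0 < s) :
    Filter.Tendsto (fun N : ℕ => Real.log (Real.log N) ^ r / Real.log N ^ s) Filter.atTop
      (nhds 0) :=
  ((isLittleO_log_rpow_rpow_atTop r hs).tendsto_div_nhds_zero).comp tendsto_log_natCast

theorem tendsto_one_div_cutoff :
    Filter.Tendsto (fun N : ℕ => 1 / cutoff N) Filter.atTop (nhds 0) := by
  have h := tendsto_log_log_rpow_div_log_rpow 1 one_pos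
  simp only [Real.rpow_one] at h
  simpa only [cutoff, one_div_div] using h

theorem tendsto_errorBound {a η : ℝ} (h : a + 1 < η) :
    Filter.Tendsto (errorBound a η) Filter.atTop (nhds 0) := by
  have h1 := tendsto_one_div_cutoff.add
    (tendsto_log_log_rpow_div_log_rpow (η - 1) (sub_pos.2 h))
  rw [add_zero] at h1
  refine h1.congr' ?_
  filter_upwards [eventually_one_le_log_log] with N hN
  rw [errorBound, cutoff_rpow_mul_eq hN]

/-- The second term of `errorBound` is the first times `ℓ^(η - 2) / L^(η - (a + 2))`, which tends to
`0`. -/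
theorem errorBound_isBigO_of_lt {a η : ℝ} (h : a + 2 < η) :
    errorBound a η =O[Filter.atTop] fun N : ℕ => Real.log (Real.log N) / Real.log N := by
  have h1 := (tendsto_log_log_rpow_div_log_rpow (η - 2) (s := η - (a + 2)) (by linarith)).eventually
    (gt_mem_nhds one_pos)
  refine Asymptotics.IsBigO.of_bound 2 ?_
  filter_upwards [h1, eventually_one_le_log_log] with N hN hℓ
  obtain ⟨-, hL, hR, -⟩ := one_le_cutoff_of_one_le_log_log hℓ
  have hL0 : 0 < Real.log N := by linarith
  have hℓ0 : 0 < Real.log (Real.log N) := by linarith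
  have h2 : Real.log (Real.log N) ^ (η - 1) / Real.log N ^ (η - (a + 1)) =
      Real.log (Real.log N) / Real.log N *
        (Real.log (Real.log N) ^ (η - 2) / Real.log N ^ (η - (a + 2))) := by
    rw [show η - 1 = 1 + (η - 2) by ring, show η - (a + 1) = 1 + (η - (a + 2)) by ring,
      Real.rpow_add hℓ0, Real.rpow_add hL0, Real.rpow_one, Real.rpow_one, mul_div_mul_comm]
  have h3 : 0 < Real.log (Real.log N) / Real.log N := by positivity
  rw [errorBound, cutoff_rpow_mul_eq hℓ, h2, cutoff, one_div_div,
    Real.norm_of_nonneg (by positivity), Real.norm_of_nonneg h3.le]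
  nlinarith

/-- Here `a + 1 - η ≥ -1`, so the second term of `errorBound` dominates `1 / R`. -/
theorem errorBound_isBigO_of_le {a η : ℝ} (ha : 0 ≤ a) (h : η ≤ a + 2) :
    errorBound a η =O[Filter.atTop] fun N : ℕ =>
      Real.log (Real.log N) ^ (η - 1) / Real.log N ^ (η - (a + 1)) := by
  refine Asymptotics.IsBigO.of_bound 2 ?_
  filter_upwards [eventually_one_le_log_log] with N hℓ
  obtain ⟨-, hL, hR, -⟩ := one_le_cutoff_of_one_le_log_log hℓ
  have hR0 : 0 < cutoff N := by linarith
  have h1 : 1 / cutoff N ≤ cutoff N ^ (a + 1 - η) * Real.log (Real.log N) ^ a := by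
    have h2 : 1 / cutoff N ≤ cutoff N ^ (a + 1 - η) := by
      rw [one_div, ← Real.rpow_neg_one]
      exact Real.rpow_le_rpow_of_exponent_le hR (by linarith)
    exact h2.trans (le_mul_of_one_le_right (by positivity) (Real.one_le_rpow hℓ ha))
  rw [← cutoff_rpow_mul_eq hℓ, errorBound, Real.norm_of_nonneg (by positivity),
    Real.norm_of_nonneg (by positivity)]
  linarith

theorem corollary1 (k : ℕ) (hk : 2 ≤ k) (α : ℂ) (hα0 : α ≠ 0) (hα : ‖α‖ < 2) :
    ∃ C : ℂ, C ≠ 0 ∧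
      ∀ (η : ℝ) (f fhat : ℝ → ℂ), ‖α‖ - α.re < η →
        (∃ M : ℝ, ∀ x : ℝ, ‖f x‖ ≤ M) → (1 < η → Continuous f) →
        f ∈ fourierDecay η → IsFourierTransform f fhat →
        ∃ ε : ℕ → ℂ,
          (∀ N : ℕ, 2 ≤ N →
            smoothSum f k α N = C * (Real.log N : ℂ) ^ α *
              ((∫ t in {t : ℝ | |t| ≤ cutoff N}, dickmanChar α t * fhat t) + ε N)) ∧
          (‖α‖ - α.re + 1 < η → Filter.Tendsto ε Filter.atTop (nhds 0)) ∧
          (‖α‖ - α.re + 2 < η →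
            ε =O[Filter.atTop] fun N : ℕ => Real.log (Real.log N) / Real.log N) ∧
          (η ≤ ‖α‖ - α.re + 2 →
            ε =O[Filter.atTop] fun N : ℕ =>
              Real.log (Real.log N) ^ (η - 1) /
                Real.log N ^ (η - (‖α‖ - α.re + 1))) := by
  obtain ⟨C, K₁, hC, hK₁, h₁⟩ := exists_smoothEulerProduct_eq hk hα
  obtain ⟨K₂, hK₂, h₂⟩ := exists_smoothEulerProduct_norm_le hk hα
  refine ⟨C, hC, fun η f fhat hη hM hcont hdecay hfhat => ?_⟩
  obtain ⟨M, hM⟩ := hM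
  obtain ⟨g, hfg, A, hA, hgA⟩ := hdecay
  have ha : 0 ≤ ‖α‖ - α.re := sub_nonneg.2 (Complex.re_le_norm α)
  have hη0 : 0 < η := by linarith
  have hgA' : ∀ t, ‖g t‖ ≤ (A * 2 ^ η) * (1 + |t|) ^ (-η) := fun t => by
    refine (hgA t).trans ?_
    rw [div_eq_mul_one_div, mul_assoc]
    gcongr
    exact one_div_one_add_rpow_le hη0 t
  have hA' : 0 < A * 2 ^ η := by positivity
  -- The decay is known for some transform `g`, not for the given `fhat`; they agree almost
  -- everywhere, so the truncated integrals coincide.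
  have hε : smoothSumError f fhat k α C = smoothSumError f g k α C := by
    ext N
    rw [smoothSumError, smoothSumError]
    congr 1
    refine MeasureTheory.integral_congr_ae (MeasureTheory.ae_restrict_of_ae ?_)
    filter_upwards [hfhat.ae_eq hfg] with t ht
    rw [ht]
  have hbound : ∃ K : ℝ, ∀ N : ℕ, 1 ≤ Real.log (Real.log N) →
      ‖smoothSumError f g k α C N‖ ≤ K * errorBound (‖α‖ - α.re) η N := by
    rcases lt_or_ge 1 η with h1 | h1
    · have hgm := hfg.locallyIntegrable.aestronglyMeasurable
      refine exists_norm_smoothSumError_le_of_one_lt hk hα0 hC hK₁ hK₂ h₁ h₂ h1 hgm hA' hgA' ?_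
      exact hfg.eq_integral (hcont h1) (((integrable_one_add_abs_rpow h1).const_mul _).mono' hgm
        (Filter.Eventually.of_forall hgA'))
    · exact exists_norm_smoothSumError_le_of_le_one hk hα0 hC hK₂ h₂ h1 hM hA' hgA'
  obtain ⟨K, hK⟩ := hbound
  have hO : smoothSumError f fhat k α C =O[Filter.atTop] errorBound (‖α‖ - α.re) η := by
    refine Asymptotics.IsBigO.of_bound |K| ?_
    filter_upwards [eventually_one_le_log_log] with N hN
    rw [hε]
    refine (hK N hN).trans ((le_abs_self _).trans ?_)
    rw [abs_mul, Real.norm_eq_abs]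
  refine ⟨smoothSumError f fhat k α C, fun N hN => ?_, fun h => ?_, fun h => ?_, fun h => ?_⟩
  · have hL : ((Real.log N : ℝ) : ℂ) ≠ 0 := by
      exact_mod_cast (Real.log_pos (by exact_mod_cast (by omega : 1 < N))).ne'
    rw [smoothSumError, add_sub_cancel, mul_div_cancel₀]
    exact mul_ne_zero hC fun h0 => hL ((Complex.cpow_eq_zero_iff _ _).1 h0).1
  · exact hO.trans_tendsto (tendsto_errorBound h)
  · exact hO.trans (errorBound_isBigO_of_lt h)
  · exact hO.trans (errorBound_isBigO_of_le ha h)
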